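/- **Theorem 8.1.3.** Let $X = G/H$ be a riemannian homogeneous space: $G$ is a Lie group, $H\subset G$ a closed subgroup, and $X$ carries a $G$-invariant riemannian metric. Let $J^2(X)\to X$ be the bundle of 2-jets of functions, and let $F\subset J^2(X)$ be a subequation which is invariant under the natural action $a\cdot J^2_xf = J^2_{ax}(f\circ a^{-1})$ of $G$ on $J^2(X)$. Let $\Omega\subset\subset X$ be a connected, relatively compact domain with non-empty smooth boundary $\partial\Omega$ which is both strictly $F$-convex and strictly $\widetilde F$-convex. Then existence holds for the Dirichlet problem for $F$-harmonic functions on $\Omega$: for every $\varphi\in C(\partial\Omega)$ there is $u\in C(\overline\Omega)$ which is $F$-harmonic on $\Omega$ and satisfies $u|_{\partial\Omega}=\varphi$. Here the following definitions are used. * A *subequation* is a closed set $F\subset J^2(X)$ with $F+\mathcal P\subset F$ and $F+\mathcal N\subset F$ (fibrewise sums), where $\mathcal P=\{A\in \mathrm{Sym}^2(T^*X): A\ge 0\}$ and $\mathcal N$ is the set of 2-jets of constant functions $\le 0$, and with $F=\overline{\mathrm{Int} F}$, $F_x=\overline{\mathrm{Int} F_x}$ and $\mathrm{Int} F_x=(\mathrm{Int}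 F)_x$ for all $x\in X$ (where $\mathrm{Int} F_x$ is the interior relative to the fibre). Its *dual* is $\widetilde F=-(J^2(X)\setminus \mathrm{Int} F)$. * An upper semicontinuous function $u:\Omega\to[-\infty,\infty)$ is *$F$-subharmonic* if $J^2_x\psi\in F$ whenever $x\in\Omega$ and $\psi$ is a $C^2$ function near $x$ with $u\le\psi$ near $x$ and $u(x)=\psi(x)$. A function $u$ is *$F$-harmonic* if $u$ is $F$-subharmonic and $-u$ is $\widetilde F$-subharmonic. * Write $J^2(X)=\mathbf R\oplus J^2_{\mathrm{red}}(X)$, where $\mathbf R$ records the value of the function, and for $\lambda\in\mathbf R$ let $F_\lambda=\{J\in J^2_{\mathrm{red}}(X): (\lambda,J)\in F\}$. The *asymptotic interior* $\overrightarrow{F_\lambda}$ is the set of $J\in J^2_{\mathrm{red}}(X)$ having a neighbourhood $N$ in the total space $J^2_{\mathrm{red}}(X)$ and a number $t_0>0$ with $t\cdot N\subset F_\lambda$ for all $t\ge t_0$. * $\partial\Omega$ is *strictly $F$-convex* if for every $x\in\partial\Omega$ and every $\lambda\in\mathbf R$ there is a smooth function $\rho$ on a neighbourhood $U$ of $x$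 with $\{\rho=0\}=\partial\Omega\cap U$, $d\rho\neq0$ on $\partial\Omega\cap U$, $\rho<0$ on $\Omega\cap U$, and $J^2_{\mathrm{red},z}\,\rho\in\overrightarrow{F_\lambda}$ for all $z\in U$. -/

import Mathlib

open Set Filter Topology
open scoped Manifold ContDiff

noncomputable section

namespace JetDirichlet

/-- `Sym²(E*)`: symmetric bilinear forms on `E`. -/
def SymForm (E : Type*) [NormedAddCommGroup E] [NormedSpace ℝ E] :
    @Submodule ℝ (E →L[ℝ] E →L[ℝ] ℝ) _
      SeminormedAddCommGroup.toAddCommGroup.toAddCommMonoid NormedSpace.toModule where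
  carrier := {B | ∀ v w, B v w = B w v}
  add_mem' hA hB v w := congrArg₂ (· + ·) (hA v w) (hB v w)
  zero_mem' _ _ := rfl
  smul_mem' c _ hA v w := congrArg (c * ·) (hA v w)

section Model

variable (E : Type*) [NormedAddCommGroup E] [NormedSpace ℝ E]

instance : NormedAddCommGroup (SymForm E) := inferInstance

instance : NormedSpace ℝ (SymForm E) := inferInstance

variable {E} in
/-- The symmetric part of a bilinear form. It is only applied to second derivatives, which are
already symmetric for `C²` functions; it serves to land in `SymForm` without a side condition. -/
def symPart (B : E →L[ℝ] E →L[ℝ] ℝ) : SymForm E :=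
  ⟨(1 / 2 : ℝ) • (B + B.flip), fun v w =>
    congrArg ((1 / 2 : ℝ) * ·) (add_comm (B v w) (B w v))⟩

/-- The reduced 2-jets `(p, A)` in coordinates. -/
abbrev RedFibre : Type _ := (E →L[ℝ] ℝ) × SymForm E

/-- The 2-jets `(r, (p, A))` in coordinates. -/
abbrev JetFibre : Type _ := ℝ × RedFibre E

/-- The total space of the bundle `J²(X)` of 2-jets of functions on a manifold `X` modelled on `E`.
As for Mathlib's `TangentSpace`, an element of the fibre over `x` is recorded by its coordinates
`(r, p, A)` in the preferred chart at `x`. -/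
@[ext] structure Jet2 (X : Type*) where
  base : X
  val : JetFibre E

/-- The total space of the bundle of reduced 2-jets, `J²(X) = ℝ ⊕ J²_red(X)`. -/
@[ext] structure RedJet2 (X : Type*) where
  base : X
  val : RedFibre E

variable {E} {X : Type*}

/-- The reduced jet `j` together with the value `r`, for the splitting `J²(X) = ℝ ⊕ J²_red(X)`. -/
def RedJet2.withValue (r : ℝ) (j : RedJet2 E X) : Jet2 E X :=
  ⟨j.base, (r, j.val)⟩

/-- Fibrewise scalar multiplication. -/
def RedJet2.scale (t : ℝ) (j : RedJet2 E X) : RedJet2 E X :=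
  ⟨j.base, t • j.val⟩

/-- Fibrewise negation. -/
def Jet2.neg (j : Jet2 E X) : Jet2 E X :=
  ⟨j.base, -j.val⟩

/-- The fibre `F_x` of a subset `F` of the jet bundle. -/
def fibre (F : Set (Jet2 E X)) (x : X) : Set (JetFibre E) :=
  {v | (⟨x, v⟩ : Jet2 E X) ∈ F}

end Model

section Manifold

variable {E : Type*} [NormedAddCommGroup E] [NormedSpace ℝ E]
  {X : Type*} [TopologicalSpace X] [ChartedSpace E X]

/-- Value, first and second derivative of `f` at `x`, computed in the preferred chart at `c`. -/
def jetInChart (c : X) (f : X → ℝ) (x : X) : JetFibre E :=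
  let h : E → ℝ := fun y => f ((extChartAt 𝓘(ℝ, E) c).symm y)
  let y : E := extChartAt 𝓘(ℝ, E) c x
  (f x, fderiv ℝ h y, symPart (fderiv ℝ (fderiv ℝ h) y))

/-- The 2-jet `J²_x f`. -/
def jet2 (f : X → ℝ) (x : X) : Jet2 E X := ⟨x, jetInChart x f x⟩

/-- The reduced 2-jet `J²_{red,x} f`. -/
def redJet2 (f : X → ℝ) (x : X) : RedJet2 E X := ⟨x, (jetInChart x f x).2⟩

/-- A function, smooth near `j.base`, whose 2-jet at `j.base` is `j`: the quadratic Taylor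
polynomial in the preferred chart at `j.base`. -/
def Jet2.rep (j : Jet2 E X) (z : X) : ℝ :=
  let w : E := extChartAt 𝓘(ℝ, E) j.base z - extChartAt 𝓘(ℝ, E) j.base j.base
  j.val.1 + j.val.2.1 w + (1 / 2 : ℝ) * (j.val.2.2 : E →L[ℝ] E →L[ℝ] ℝ) w w

/-- The coordinates of a 2-jet induced by the preferred chart at `c`; meaningful when `j.base`
lies in the domain of that chart. -/
def Jet2.coord (c : X) (j : Jet2 E X) : E × JetFibre E :=
  (extChartAt 𝓘(ℝ, E) c j.base, jetInChart c j.rep j.base)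

/-- The topology of the total space of `J²(X)`: the sets that are open in the coordinates induced
by some chart generate it. -/
instance : TopologicalSpace (Jet2 E X) :=
  TopologicalSpace.generateFrom
    {U | ∃ (c : X) (V : Set (E × JetFibre E)), IsOpen V ∧
      U = {j | j.base ∈ (chartAt E c).source ∧ j.coord c ∈ V}}

/-- The topology of the total space of `J²_red(X)`, as the subbundle of jets with value `0`. -/
instance : TopologicalSpace (RedJet2 E X) :=
  TopologicalSpace.induced (RedJet2.withValue 0) inferInstance

/-- A subequation on `X`: a closed subset of `J²(X)` with the positivity, negativity and
topological conditions. -/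
structure IsSubequation (F : Set (Jet2 E X)) : Prop where
  isClosed : IsClosed F
  positivity : ∀ (x : X) (r : ℝ) (p : E →L[ℝ] ℝ) (A P : SymForm E),
    (∀ v, 0 ≤ (P : E →L[ℝ] E →L[ℝ] ℝ) v v) →
    (⟨x, (r, p, A)⟩ : Jet2 E X) ∈ F → (⟨x, (r, p, A + P)⟩ : Jet2 E X) ∈ F
  negativity : ∀ (x : X) (r s : ℝ) (q : RedFibre E), s ≤ 0 →
    (⟨x, (r, q)⟩ : Jet2 E X) ∈ F → (⟨x, (r + s, q)⟩ : Jet2 E X) ∈ F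
  eq_closure_interior : F = closure (interior F)
  fibre_eq_closure_interior : ∀ x, fibre F x = closure (interior (fibre F x))
  interior_fibre : ∀ x, interior (fibre F x) = fibre (interior F) x

/-- The dual subequation `F̃ = -(∼ Int F)`. -/
def dual (F : Set (Jet2 E X)) : Set (Jet2 E X) := {j | j.neg ∉ interior F}

/-- `u` is `F`-subharmonic on the open set `Ω`: it is upper semicontinuous with values in
`[-∞, ∞)`, and the 2-jet at `x ∈ Ω` of every `C²` test function for `u` at `x` lies in `F`. -/
def IsSubharmonicOn (F : Set (Jet2 E X)) (Ω : Set X) (u : X → EReal) : Prop :=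
  UpperSemicontinuousOn u Ω ∧ (∀ x ∈ Ω, u x < ⊤) ∧
    ∀ x ∈ Ω, ∀ φ : X → ℝ, ContMDiffAt 𝓘(ℝ, E) 𝓘(ℝ, ℝ) 2 φ x →
      (∀ᶠ z in 𝓝 x, u z ≤ (φ z : EReal)) → u x = (φ x : EReal) → jet2 φ x ∈ F

/-- `u` is `F`-harmonic on `Ω`: `u` is `F`-subharmonic and `-u` is `F̃`-subharmonic there. -/
def IsHarmonicOn (F : Set (Jet2 E X)) (Ω : Set X) (u : X → ℝ) : Prop :=
  IsSubharmonicOn F Ω (fun x => (u x : EReal)) ∧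
    IsSubharmonicOn (dual F) Ω (fun x => ((-u x : ℝ) : EReal))

/-- The reduced subequation `F_l`, obtained by fixing the value of the function to be `l`. -/
def fixValue (F : Set (Jet2 E X)) (l : ℝ) : Set (RedJet2 E X) := {j | j.withValue l ∈ F}

/-- The asymptotic interior of a subset of `J²_red(X)`. -/
def asymptoticInterior (F : Set (RedJet2 E X)) : Set (RedJet2 E X) :=
  {J | ∃ N ∈ 𝓝 J, ∃ t₀ : ℝ, 0 < t₀ ∧ ∀ t ≥ t₀, ∀ J' ∈ N, J'.scale t ∈ F}

/-- `ρ` is a smooth defining function for `∂Ω` on the open set `U`. -/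
structure IsDefiningFunctionOn (Ω U : Set X) (ρ : X → ℝ) : Prop where
  smooth : ContMDiffOn 𝓘(ℝ, E) 𝓘(ℝ, ℝ) ∞ ρ U
  zero_iff : ∀ z ∈ U, ρ z = 0 ↔ z ∈ frontier Ω
  deriv_ne_zero : ∀ z ∈ U, z ∈ frontier Ω → mfderiv 𝓘(ℝ, E) 𝓘(ℝ, ℝ) ρ z ≠ 0
  neg : ∀ z ∈ U, z ∈ Ω → ρ z < 0

/-- `∂Ω` is strictly `F`-convex at `x`, for a reduced subequation `F`: near `x` there is a
defining function whose reduced 2-jets lie in the asymptotic interior of `F`. -/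
def RedStrictlyConvexAt (F : Set (RedJet2 E X)) (Ω : Set X) (x : X) : Prop :=
  ∃ (U : Set X) (ρ : X → ℝ), IsOpen U ∧ x ∈ U ∧ IsDefiningFunctionOn (E := E) Ω U ρ ∧
    ∀ z ∈ U, redJet2 ρ z ∈ asymptoticInterior F

/-- `∂Ω` is strictly `F`-convex: at each of its points it is strictly `F_l`-convex for every real
value `l`. In particular `∂Ω` is then smooth, with `Ω` locally on one side. -/
def HasStrictlyConvexBoundary (F : Set (Jet2 E X)) (Ω : Set X) : Prop :=
  ∀ x ∈ frontier Ω, ∀ l : ℝ, RedStrictlyConvexAt (fixValue F l) Ω x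

/-- Existence holds for the Dirichlet problem for `F`-harmonic functions on `Ω`. -/
def DirichletExistence (F : Set (Jet2 E X)) (Ω : Set X) : Prop :=
  ∀ φ : X → ℝ, ContinuousOn φ (frontier Ω) →
    ∃ u : X → ℝ, ContinuousOn u (closure Ω) ∧ IsHarmonicOn F Ω u ∧ ∀ x ∈ frontier Ω, u x = φ x

/-- `F ⊆ J²(X)` is invariant under the natural action `a • J²_x f = J²_{a • x} (f ∘ a⁻¹)`. -/
def IsJetInvariant (G : Type*) [Group G] [MulAction G X] (F : Set (Jet2 E X)) : Prop :=
  ∀ (a : G) (x : X) (f : X → ℝ), ContMDiffAt 𝓘(ℝ, E) 𝓘(ℝ, ℝ) 2 f x →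
    jet2 f x ∈ F → jet2 (fun z => f (a⁻¹ • z)) (a • x) ∈ F

/-- Smooth riemannian metrics on `X`. -/
abbrev SmoothMetric (E : Type*) [NormedAddCommGroup E] [NormedSpace ℝ E]
    (X : Type*) [TopologicalSpace X] [ChartedSpace E X] [IsManifold 𝓘(ℝ, E) ∞ X] : Type _ :=
  Bundle.ContMDiffRiemannianMetric 𝓘(ℝ, E) ∞ E (fun x : X => TangentSpace 𝓘(ℝ, E) x)

/-- The group `G` acts on `X` by isometries of the riemannian metric `g`. -/
def IsMetricInvariant (G : Type*) [Group G] [MulAction G X] [IsManifold 𝓘(ℝ, E) ∞ X]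
    (g : SmoothMetric E X) : Prop :=
  ∀ (a : G) (x : X) (v w : TangentSpace 𝓘(ℝ, E) x),
    g.inner (a • x) (mfderiv 𝓘(ℝ, E) 𝓘(ℝ, E) (fun z : X => a • z) x v)
      (mfderiv 𝓘(ℝ, E) 𝓘(ℝ, E) (fun z : X => a • z) x w) = g.inner x v w

end Manifold

end JetDirichlet

end

/-! This is Perron's method without a comparison theorem; invariance under `G` takes its place
twice.

Competitors are upper semicontinuous functions `≥ -k` with boundary values `≤ φ`, required to be
subharmonic only where they exceed `-k`. Strict convexity gives a barrier at each boundary point: a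
function that peaks there within `closure Ω` and whose large multiples have reduced jets in the
fixed-value fibres. Barriers for `dual F` press all competitors down near the boundary
(`eventually_competitor_le`); barriers for `F`, glued to the constant `-k`, give competitors
reaching almost up to `φ` (`exists_competitor_ge`). Hence the upper envelope of the supremum is a
largest competitor `U`, and it takes the values `φ` continuously (`exists_maximal_competitor`).

Interior continuity is Walsh's argument. For `a` near `1`, the translate `U (a • x) - ε`, glued to
`U`, is again a competitor by invariance, hence `≤ U`; open orbit maps turn this into lower
semicontinuity. A bump added to `U` wherever `-U` fails to be subharmonic for `dual F` would
contradict maximality.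

Two things remain: competitors must be bounded above, and `U` must stay above `-k`. Both follow from
`exists_upper_bound`. If subharmonic functions with bounded boundary values had maxima `M j → ∞`,
the points where `v j / M j` comes close to `1` would form a compact set `Z`. A barrier scaled by `ε
* M j` shows that such a set cannot touch the boundary from inside. But if `Z` lies in `Ω`, some
translation makes it touch the boundary without leaving `closure Ω`, and invariance lets the same
barrier argument apply to the translates. For `F` this bounds the competitors, and for `dual F` it
bounds `-U` independently of `k`, so a large `k` makes the truncation inactive. -/

noncomputable section

namespace JetDirichlet

/-! ### Second-order calculus on the model space. -/

section SecondOrder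

variable {E : Type*} [NormedAddCommGroup E] [NormedSpace ℝ E]

/-- A function with vanishing first and second derivative at a point keeps this property after
precomposition with a `C²` map. -/
theorem fderiv_comp_eq_zero_of_two {E' : Type*} [NormedAddCommGroup E'] [NormedSpace ℝ E']
    {h : E → ℝ} {τ : E' → E} {e : E'}
    (hh : ContDiffAt ℝ 2 h (τ e)) (hτ : ContDiffAt ℝ 2 τ e)
    (h1 : fderiv ℝ h (τ e) = 0) (h2 : fderiv ℝ (fderiv ℝ h) (τ e) = 0) :
    fderiv ℝ (fun y => h (τ y)) e = 0 ∧ fderiv ℝ (fderiv ℝ (fun y => h (τ y))) e = 0 := by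
  have hev : fderiv ℝ (fun y => h (τ y)) =ᶠ[𝓝 e]
      fun y => (fderiv ℝ h (τ y)).comp (fderiv ℝ τ y) := by
    have a1 := hτ.continuousAt.eventually (hh.eventually (by simp))
    have a2 := hτ.eventually (by simp)
    filter_upwards [a1, a2] with y b1 b2
    exact fderiv_comp y (b1.differentiableAt (by simp)) (b2.differentiableAt (by simp))
  constructor
  · rw [hev.eq_of_nhds, h1, ContinuousLinearMap.zero_comp]
  · rw [hev.fderiv_eq]
    have d1 : HasFDerivAt (fun y => fderiv ℝ h (τ y)) (0 : E' →L[ℝ] E →L[ℝ] ℝ) e := by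
      have := (hh.fderiv_right (m := 1) (by norm_num)).differentiableAt (by simp)
      have := this.hasFDerivAt.comp e (hτ.differentiableAt (by simp)).hasFDerivAt
      rwa [h2, ContinuousLinearMap.zero_comp] at this
    have d2 : HasFDerivAt (fderiv ℝ τ) (fderiv ℝ (fderiv ℝ τ) e) e :=
      ((hτ.fderiv_right (m := 1) (by norm_num)).differentiableAt (by simp)).hasFDerivAt
    -- In the product rule one term contains the second derivative of `h`, zero by `h2`; the other
    -- composes the second derivative of `τ` with the first derivative of `h`, zero by `h1`.
    have := (d1.clm_comp d2).fderiv
    rw [this]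
    ext v w
    simp [h1]

/-- At a local minimum of a `C²` function the second derivative is positive semidefinite. -/
theorem second_deriv_nonneg_of_isLocalMin {h : E → ℝ} {e : E} (hh : ContDiffAt ℝ 2 h e)
    (hmin : IsLocalMin h e) (v : E) : 0 ≤ fderiv ℝ (fderiv ℝ h) e v v := by
  by_contra! hneg
  set γ : ℝ → E := fun t => e + t • v with hγ
  have hγ0 : γ 0 = e := by simp [γ]
  have hγd : ∀ t, HasDerivAt γ v t := fun t => by
    simpa [γ] using ((hasDerivAt_id t).smul_const v).const_add e
  have hγc : ContinuousAt γ 0 := (hγd 0).continuousAt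
  have hder : deriv (fun t => h (γ t)) =ᶠ[𝓝 0] fun t => fderiv ℝ h (γ t) v := by
    have := hγc.eventually (by rw [hγ0]; exact hh.eventually (by simp))
    filter_upwards [this] with t ht
    exact ((ht.differentiableAt (by simp)).hasFDerivAt.comp_hasDerivAt t (hγd t)).deriv
  have hsecond : deriv (deriv (fun t => h (γ t))) 0 = fderiv ℝ (fderiv ℝ h) e v v := by
    rw [hder.deriv_eq]
    have h2 : DifferentiableAt ℝ (fderiv ℝ h) (γ 0) := by
      rw [hγ0]; exact (hh.fderiv_right (m := 1) (by norm_num)).differentiableAt (by simp)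
    have := (h2.hasFDerivAt.comp_hasDerivAt (0 : ℝ) (hγd 0)).clm_apply (hasDerivAt_const (0 : ℝ) v)
    rw [hγ0] at this
    simpa using this.deriv
  have hmin' : IsLocalMin (fun t => h (γ t)) 0 := by
    have := hγc.eventually (by rw [hγ0]; exact hmin)
    filter_upwards [this] with t ht
    simpa [hγ0] using ht
  have hd0 : deriv (fun t => h (γ t)) 0 = 0 := hmin'.deriv_eq_zero
  have hcont : ContinuousAt (fun t => h (γ t)) 0 :=
    ContinuousAt.comp (f := γ) (g := h) (by rw [hγ0]; exact hh.continuousAt) hγc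
  -- A negative second derivative makes the minimum along the line a local maximum as well, so the
  -- restriction is locally constant and its second derivative is zero.
  have hmax := isLocalMax_of_deriv_deriv_neg (hsecond ▸ hneg) hd0 hcont
  have hconst : (fun t => h (γ t)) =ᶠ[𝓝 0] fun _ => h (γ 0) := by
    filter_upwards [hmin', hmax] with t h1 h2
    exact le_antisymm h2 h1
  have : deriv (deriv (fun t => h (γ t))) 0 = 0 := by
    rw [hconst.deriv.deriv_eq]; simp
  linarith

theorem symPart_add (B C : E →L[ℝ] E →L[ℝ] ℝ) : symPart (B + C) = symPart B + symPart C := by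
  apply Subtype.ext
  ext v w
  simp [symPart]
  ring

theorem symPart_smul (s : ℝ) (B : E →L[ℝ] E →L[ℝ] ℝ) : symPart (s • B) = s • symPart B := by
  apply Subtype.ext
  ext v w
  simp [symPart]
  ring

theorem continuous_symPart : Continuous (symPart : (E →L[ℝ] E →L[ℝ] ℝ) → SymForm E) := by
  refine Continuous.subtype_mk ?_ _
  exact (continuous_id.add (ContinuousLinearMap.flipₗᵢ ℝ E E ℝ).continuous).const_smul (1 / 2 : ℝ)

theorem symPart_zero : symPart (0 : E →L[ℝ] E →L[ℝ] ℝ) = 0 := by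
  apply Subtype.ext
  ext
  simp [symPart]

theorem symPart_coe (A : SymForm E) : symPart (A : E →L[ℝ] E →L[ℝ] ℝ) = A := by
  apply Subtype.ext
  ext v w
  have := A.2 v w
  simp [symPart]
  linarith

theorem coe_symPart_of_isSymm {B : E →L[ℝ] E →L[ℝ] ℝ} (hB : ∀ v w, B v w = B w v) :
    (symPart B : E →L[ℝ] E →L[ℝ] ℝ) = B := by
  ext v w
  simp [symPart, hB w v]
  ring

/-- The derivatives of a quadratic polynomial at its centre. -/
theorem fderiv_quadratic (r : ℝ) (p : E →L[ℝ] ℝ) (A : SymForm E) (e : E) :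
    fderiv ℝ (fun y => r + p (y - e) + (1 / 2 : ℝ) * (A : E →L[ℝ] E →L[ℝ] ℝ) (y - e) (y - e)) =
      fun y => p + (A : E →L[ℝ] E →L[ℝ] ℝ) (y - e) := by
  ext y v
  have h0 : HasFDerivAt (fun y : E => y - e) (ContinuousLinearMap.id ℝ E) y :=
    (hasFDerivAt_id y).sub_const e
  have h1 : HasFDerivAt (fun y : E => (A : E →L[ℝ] E →L[ℝ] ℝ) (y - e))
      ((A : E →L[ℝ] E →L[ℝ] ℝ).comp (ContinuousLinearMap.id ℝ E)) y :=
    (A : E →L[ℝ] E →L[ℝ] ℝ).hasFDerivAt.comp y h0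
  have h2 := ((p.hasFDerivAt.comp y h0).const_add r).add ((h1.clm_apply h0).const_mul (1 / 2 : ℝ))
  have h3 := h2.fderiv
  simp only [Function.comp_def, Pi.add_def] at h3
  rw [h3]
  have := A.2 (y - e) v
  simp only [_root_.add_apply, _root_.smul_apply, smul_eq_mul,
    ContinuousLinearMap.comp_apply, ContinuousLinearMap.flip_apply,
    ContinuousLinearMap.id_apply]
  linarith

theorem contDiff_quadratic (r : ℝ) (p : E →L[ℝ] ℝ) (A : SymForm E) (e : E) :
    ContDiff ℝ 2
      (fun y => r + p (y - e) + (1 / 2 : ℝ) * (A : E →L[ℝ] E →L[ℝ] ℝ) (y - e) (y - e)) := by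
  fun_prop

end SecondOrder

/-! ### Jets of functions in charts and under pull-back. -/

section Charts

variable {E : Type*} [NormedAddCommGroup E] [NormedSpace ℝ E]
  {X : Type*} [TopologicalSpace X] [ChartedSpace E X]

/-- The expression of `f` in the preferred chart at `c`. -/
def inChart (c : X) (f : X → ℝ) (y : E) : ℝ := f ((extChartAt 𝓘(ℝ, E) c).symm y)

theorem jetInChart_eq (c : X) (f : X → ℝ) (x : X) :
    jetInChart (E := E) c f x = (f x, fderiv ℝ (inChart c f) (extChartAt 𝓘(ℝ, E) c x),
      symPart (fderiv ℝ (fderiv ℝ (inChart c f)) (extChartAt 𝓘(ℝ, E) c x))) := rfl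

theorem jetInChart_const (c : X) (r : ℝ) (x : X) :
    jetInChart (E := E) c (fun _ => r) x = (r, 0) := by
  have : inChart (E := E) c (fun _ : X => r) = fun _ => r := rfl
  rw [jetInChart_eq, this]
  have h : fderiv ℝ (fun _ : E => r) = fun _ => 0 := by ext; simp
  rw [h]
  simp only [fderiv_fun_const, Pi.zero_apply]
  rw [symPart_zero]
  rfl

theorem Jet2.jetInChart_rep (j : Jet2 E X) : jetInChart j.base j.rep j.base = j.val := by
  set χ := extChartAt 𝓘(ℝ, E) j.base with hχ
  have hev : inChart (E := E) j.base j.rep =ᶠ[𝓝 (χ j.base)] fun y => j.val.1 +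
      j.val.2.1 (y - χ j.base) + (1 / 2 : ℝ) *
        (j.val.2.2 : E →L[ℝ] E →L[ℝ] ℝ) (y - χ j.base) (y - χ j.base) := by
    filter_upwards [extChartAt_target_mem_nhds (I := 𝓘(ℝ, E)) j.base] with y hy
    simp only [inChart, Jet2.rep]
    rw [← hχ, χ.right_inv hy]
  have hev1 := hev.fderiv (𝕜 := ℝ)
  rw [fderiv_quadratic] at hev1
  rw [jetInChart_eq, hev1.fderiv_eq, hev1.eq_of_nhds]
  have h2 : fderiv ℝ (fun y => j.val.2.1 + (j.val.2.2 : E →L[ℝ] E →L[ℝ] ℝ) (y - χ j.base))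
      (χ j.base) = j.val.2.2 := by
    have h0 : HasFDerivAt (fun y : E => y - χ j.base) (ContinuousLinearMap.id ℝ E) (χ j.base) :=
      (hasFDerivAt_id _).sub_const _
    have := (((j.val.2.2 : E →L[ℝ] E →L[ℝ] ℝ).hasFDerivAt.comp (χ j.base) h0).const_add
      j.val.2.1).fderiv
    simpa [Function.comp_def] using this
  rw [h2, symPart_coe]
  simp [Jet2.rep]

theorem jet2_rep (j : Jet2 E X) : jet2 j.rep j.base = j := by
  ext1
  · rfl
  · exact j.jetInChart_rep

variable [IsManifold 𝓘(ℝ, E) ∞ X]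

theorem isManifold_two : IsManifold 𝓘(ℝ, E) 2 X :=
  IsManifold.of_le (n := ∞) (by decide)

theorem contDiffAt_inChart {c : X} {f : X → ℝ} {x : X} (hx : x ∈ (chartAt E c).source)
    (hf : ContMDiffAt 𝓘(ℝ, E) 𝓘(ℝ, ℝ) 2 f x) :
    ContDiffAt ℝ 2 (inChart (E := E) c f) (extChartAt 𝓘(ℝ, E) c x) := by
  have : IsManifold 𝓘(ℝ, E) 2 X := isManifold_two
  have := (contMDiffAt_iff_source_of_mem_source (I := 𝓘(ℝ, E)) (I' := 𝓘(ℝ, ℝ)) (n := 2)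
    (x := c) (x' := x) (f := f) hx).1 hf
  rw [modelWithCornersSelf_coe, range_id, contMDiffWithinAt_univ,
    contMDiffAt_iff_contDiffAt] at this
  exact this

theorem contMDiffAt_two_eventually {f : X → ℝ} {x : X}
    (hf : ContMDiffAt 𝓘(ℝ, E) 𝓘(ℝ, ℝ) 2 f x) :
    ∀ᶠ z in 𝓝 x, ContMDiffAt 𝓘(ℝ, E) 𝓘(ℝ, ℝ) 2 f z := by
  have : IsManifold 𝓘(ℝ, E) 2 X := isManifold_two
  exact (contMDiffAt_iff_contMDiffAt_nhds (by decide)).1 hf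

/-- The second derivative in a chart is symmetric. -/
theorem coe_jetInChart_snd {c : X} {f : X → ℝ} {x : X} (hx : x ∈ (chartAt E c).source)
    (hf : ContMDiffAt 𝓘(ℝ, E) 𝓘(ℝ, ℝ) 2 f x) :
    ((jetInChart (E := E) c f x).2.2 : E →L[ℝ] E →L[ℝ] ℝ) =
      fderiv ℝ (fderiv ℝ (inChart (E := E) c f)) (extChartAt 𝓘(ℝ, E) c x) :=
  coe_symPart_of_isSymm ((contDiffAt_inChart hx hf).isSymmSndFDerivAt (by simp))

theorem jetInChart_add_smul {c : X} {f g : X → ℝ} {x : X} (s : ℝ)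
    (hx : x ∈ (chartAt E c).source)
    (hf : ContMDiffAt 𝓘(ℝ, E) 𝓘(ℝ, ℝ) 2 f x) (hg : ContMDiffAt 𝓘(ℝ, E) 𝓘(ℝ, ℝ) 2 g x) :
    jetInChart (E := E) c (fun z => f z + s * g z) x =
      jetInChart c f x + s • jetInChart c g x := by
  have cf := contDiffAt_inChart hx hf
  have cg := contDiffAt_inChart hx hg
  have h1 : fderiv ℝ (inChart (E := E) c (fun z => f z + s * g z))
      =ᶠ[𝓝 (extChartAt 𝓘(ℝ, E) c x)]
      fderiv ℝ (inChart c f) + s • fderiv ℝ (inChart c g) := by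
    filter_upwards [cf.eventually (by simp), cg.eventually (by simp)] with y b1 b2
    have e1 := b1.differentiableAt (by simp)
    have e2 := b2.differentiableAt (by simp)
    exact (e1.hasFDerivAt.add (e2.hasFDerivAt.const_smul s)).fderiv
  have d1 := (cf.fderiv_right (m := 1) (by norm_num)).differentiableAt (by simp)
  have d2 := (cg.fderiv_right (m := 1) (by norm_num)).differentiableAt (by simp)
  have h2 := (d1.hasFDerivAt.add (d2.hasFDerivAt.const_smul s)).fderiv
  simp only [jetInChart_eq]
  rw [h1.fderiv_eq, h1.eq_of_nhds, h2, symPart_add, symPart_smul]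
  rfl

theorem continuousAt_jetInChart {c : X} {f : X → ℝ} {x : X} (hx : x ∈ (chartAt E c).source)
    (hf : ContMDiffAt 𝓘(ℝ, E) 𝓘(ℝ, ℝ) 2 f x) : ContinuousAt (jetInChart (E := E) c f) x := by
  have cf := contDiffAt_inChart hx hf
  have hχ : ContinuousAt (extChartAt 𝓘(ℝ, E) c) x :=
    continuousAt_extChartAt' (by simpa using hx)
  have d1 := cf.fderiv_right (m := 1) (by norm_num)
  have d2 := d1.fderiv_right (m := 0) (by norm_num)
  exact hf.continuousAt.prodMk ((ContinuousAt.comp d1.continuousAt hχ).prodMk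
    (continuous_symPart.continuousAt.comp (ContinuousAt.comp d2.continuousAt hχ)))

/-- Vanishing of the reduced 2-jet is preserved by pull-back under `C²` maps. -/
theorem jetInChart_comp_eq_zero {Y : Type*} [TopologicalSpace Y] [ChartedSpace E Y]
    [IsManifold 𝓘(ℝ, E) ∞ Y]
    {c : X} {c' : Y} {Φ : Y → X} {f : X → ℝ} {z : Y}
    (hΦ : ContMDiffAt 𝓘(ℝ, E) 𝓘(ℝ, E) 2 Φ z) (hf : ContMDiffAt 𝓘(ℝ, E) 𝓘(ℝ, ℝ) 2 f (Φ z))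
    (hc : Φ z ∈ (chartAt E c).source) (hc' : z ∈ (chartAt E c').source)
    (h0 : (jetInChart (E := E) c f (Φ z)).2 = 0) :
    (jetInChart (E := E) c' (fun w => f (Φ w)) z).2 = 0 := by
  have : IsManifold 𝓘(ℝ, E) 2 X := isManifold_two
  have : IsManifold 𝓘(ℝ, E) 2 Y := isManifold_two
  set χ := extChartAt 𝓘(ℝ, E) c with hχ
  set χ' := extChartAt 𝓘(ℝ, E) c' with hχ'
  set τ : E → E := fun y => χ (Φ (χ'.symm y)) with hτdef
  have hz : χ'.symm (χ' z) = z := χ'.left_inv (by simpa [χ'] using hc')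
  have hτz : τ (χ' z) = χ (Φ z) := by simp only [τ, hz]
  have hτ : ContDiffAt ℝ 2 τ (χ' z) := by
    have h1 := (contMDiffAt_iff_source_of_mem_source (I := 𝓘(ℝ, E)) (I' := 𝓘(ℝ, E)) (n := 2)
      (x := c') (x' := z) (f := Φ) hc').1 hΦ
    rw [modelWithCornersSelf_coe, range_id, contMDiffWithinAt_univ] at h1
    have h2 : ContMDiffAt 𝓘(ℝ, E) 𝓘(ℝ, E) 2 χ (Φ z) := contMDiffAt_extChartAt' hc
    have h3 : ContMDiffAt 𝓘(ℝ, E) 𝓘(ℝ, E) 2 τ (χ' z) := by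
      refine ContMDiffAt.comp (f := Φ ∘ χ'.symm) (g := χ) (χ' z) ?_ h1
      simpa only [Function.comp, hz] using h2
    exact contMDiffAt_iff_contDiffAt.1 h3
  have cf := contDiffAt_inChart hc hf
  rw [← hχ, ← hτz] at cf
  have k1 : fderiv ℝ (inChart (E := E) c f) (τ (χ' z)) = 0 := by
    rw [hτz]; exact congrArg Prod.fst h0
  have k2 : fderiv ℝ (fderiv ℝ (inChart (E := E) c f)) (τ (χ' z)) = 0 := by
    rw [hτz, ← coe_jetInChart_snd hc hf, h0]; rfl
  have key := fderiv_comp_eq_zero_of_two cf hτ k1 k2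
  have hev : inChart (E := E) c' (fun w => f (Φ w)) =ᶠ[𝓝 (χ' z)]
      fun y => inChart c f (τ y) := by
    have hcont : ContinuousAt (fun y => Φ (χ'.symm y)) (χ' z) := by
      refine ContinuousAt.comp (f := χ'.symm) (g := Φ) (by rw [hz]; exact hΦ.continuousAt) ?_
      exact continuousAt_extChartAt_symm' (by simpa using hc')
    have := hcont.preimage_mem_nhds (t := (chartAt E c).source)
      (by simp only [hz]; exact (chartAt E c).open_source.mem_nhds hc)
    filter_upwards [this] with y hy
    have : χ.symm (χ (Φ (χ'.symm y))) = Φ (χ'.symm y) := χ.left_inv (by simpa [χ] using hy)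
    simp only [inChart, τ]
    rw [this]
  have hev1 := hev.fderiv (𝕜 := ℝ)
  rw [jetInChart_eq]
  rw [hev1.fderiv_eq, hev1.eq_of_nhds, key.1, key.2]
  rw [symPart_zero]
  rfl

/-- The second-order chain rule is avoided: `f - g` has zero jet, and a vanishing jet pulls back to
a vanishing jet. This makes the jet coordinates in any chart independent of the representative. -/
theorem jetInChart_comp_congr {Y : Type*} [TopologicalSpace Y] [ChartedSpace E Y]
    [IsManifold 𝓘(ℝ, E) ∞ Y]
    {c : X} {c' : Y} {Φ : Y → X} {f g : X → ℝ} {z : Y}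
    (hΦ : ContMDiffAt 𝓘(ℝ, E) 𝓘(ℝ, E) 2 Φ z) (hf : ContMDiffAt 𝓘(ℝ, E) 𝓘(ℝ, ℝ) 2 f (Φ z))
    (hg : ContMDiffAt 𝓘(ℝ, E) 𝓘(ℝ, ℝ) 2 g (Φ z))
    (hc : Φ z ∈ (chartAt E c).source) (hc' : z ∈ (chartAt E c').source)
    (h : jetInChart (E := E) c f (Φ z) = jetInChart c g (Φ z)) :
    jetInChart (E := E) c' (fun w => f (Φ w)) z = jetInChart c' (fun w => g (Φ w)) z := by
  have hd : ContMDiffAt 𝓘(ℝ, E) 𝓘(ℝ, ℝ) 2 (fun w => f w + (-1) * g w) (Φ z) :=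
    hf.add (contMDiffAt_const.mul hg)
  have h0 : jetInChart (E := E) c (fun w => f w + (-1) * g w) (Φ z) = 0 := by
    rw [jetInChart_add_smul _ hc hf hg, h]
    exact (congrArg (_ + ·) (neg_one_smul ℝ _)).trans (add_neg_cancel _)
  have h1 := jetInChart_comp_eq_zero hΦ hd hc hc' (congrArg Prod.snd h0)
  have h2 := jetInChart_add_smul (-1) hc' (hf.comp z hΦ) (hg.comp z hΦ)
  simp only [Function.comp_def] at h2
  have h3 : jetInChart (E := E) c' (fun w => f (Φ w) + (-1) * g (Φ w)) z = 0 :=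
    Prod.ext (congrArg Prod.fst h0 :) h1
  rw [h3] at h2
  exact add_neg_eq_zero.1 ((congrArg (_ + ·) (neg_one_smul ℝ _)).symm.trans h2.symm)

/-- The representative of a jet is `C²` near its base point. -/
theorem Jet2.contMDiffAt_rep (j : Jet2 E X) :
    ContMDiffAt 𝓘(ℝ, E) 𝓘(ℝ, ℝ) 2 j.rep j.base := by
  have : IsManifold 𝓘(ℝ, E) 2 X := isManifold_two
  have h1 : ContMDiffAt 𝓘(ℝ, E) 𝓘(ℝ, E) 2 (extChartAt 𝓘(ℝ, E) j.base) j.base :=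
    contMDiffAt_extChartAt
  exact (contDiff_quadratic j.val.1 j.val.2.1 j.val.2.2
    (extChartAt 𝓘(ℝ, E) j.base j.base)).contMDiff.contMDiffAt.comp j.base h1

/-- Charts compute the coordinates of the jet of a function. -/
theorem coord_jet2 {c : X} {f : X → ℝ} {x : X} (hx : x ∈ (chartAt E c).source)
    (hf : ContMDiffAt 𝓘(ℝ, E) 𝓘(ℝ, ℝ) 2 f x) :
    (jet2 (E := E) f x).coord c = (extChartAt 𝓘(ℝ, E) c x, jetInChart c f x) := by
  refine Prod.ext rfl ?_
  exact jetInChart_comp_congr (Φ := id) (c := x) (z := x) contMDiffAt_id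
    (jet2 (E := E) f x).contMDiffAt_rep hf (mem_chart_source E x) hx
    (jet2 (E := E) f x).jetInChart_rep

end Charts

/-! ### Topology of the jet bundle, and positivity for functions. -/

section JetTopology

variable {E : Type*} [NormedAddCommGroup E] [NormedSpace ℝ E]
  {X : Type*}

/-- The fibrewise map `(r, q) ↦ (α r + β, s q)` of the jet bundle. -/
def Jet2.affine (α β s : ℝ) (j : Jet2 E X) : Jet2 E X := ⟨j.base, (α * j.val.1 + β, s • j.val.2)⟩

/-- The projection `J²(X) → J²_red(X)`. -/
def Jet2.toRed (j : Jet2 E X) : RedJet2 E X := ⟨j.base, j.val.2⟩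

theorem Jet2.neg_eq_affine (j : Jet2 E X) : j.neg = j.affine (-1) 0 (-1) := by
  refine Jet2.ext rfl ?_
  refine Prod.ext (by simp [Jet2.neg, Jet2.affine]) ?_
  exact (neg_one_smul ℝ j.val.2).symm

theorem Jet2.neg_neg (j : Jet2 E X) : j.neg.neg = j := by
  refine Jet2.ext rfl ?_
  exact _root_.neg_neg j.val

variable [TopologicalSpace X] [ChartedSpace E X]

theorem Jet2.isOpen_chart (c : X) {V : Set (E × JetFibre E)} (hV : IsOpen V) :
    IsOpen {j : Jet2 E X | j.base ∈ (chartAt E c).source ∧ j.coord c ∈ V} :=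
  TopologicalSpace.isOpen_generateFrom_of_mem ⟨c, V, hV, rfl⟩

theorem Jet2.continuous_value : Continuous (fun j : Jet2 E X => j.val.1) := by
  refine continuous_def.2 fun I hI => ?_
  have : (fun j : Jet2 E X => j.val.1) ⁻¹' I = ⋃ c : X, {j : Jet2 E X |
      j.base ∈ (chartAt E c).source ∧ j.coord c ∈ {q : E × JetFibre E | q.2.1 ∈ I}} := by
    have hval : ∀ j : Jet2 E X, j.rep j.base = j.val.1 :=
      fun j => congrArg Prod.fst j.jetInChart_rep
    ext j
    simp only [mem_preimage, mem_iUnion, mem_ofPred_eq]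
    constructor
    · intro h
      refine ⟨j.base, mem_chart_source E j.base, ?_⟩
      change j.rep j.base ∈ I
      rwa [hval]
    · rintro ⟨c, -, h⟩
      change j.rep j.base ∈ I at h
      rwa [hval] at h
  rw [this]
  exact isOpen_iUnion fun c =>
    Jet2.isOpen_chart c (hI.preimage (continuous_fst.comp continuous_snd))

variable [IsManifold 𝓘(ℝ, E) ∞ X]

theorem jetInChart_smul_add_const {c : X} {f : X → ℝ} {x : X} (s r : ℝ)
    (hx : x ∈ (chartAt E c).source) (hf : ContMDiffAt 𝓘(ℝ, E) 𝓘(ℝ, ℝ) 2 f x) :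
    jetInChart (E := E) c (fun z => r + s * f z) x =
      (r + s * f x, s • (jetInChart c f x).2) := by
  have h := jetInChart_add_smul s hx (contMDiffAt_const (c := r)) hf
  rw [h, jetInChart_const]
  exact Prod.ext rfl (zero_add _)

/-- On representatives this fibrewise map is rescaling by `s` followed by adding a constant, so it
has the same form in every chart. -/
theorem Jet2.coord_affine (α β s : ℝ) {c : X} {j : Jet2 E X}
    (hj : j.base ∈ (chartAt E c).source) :
    (j.affine α β s).coord c =
      ((j.coord c).1, (α * (j.coord c).2.1 + β, s • (j.coord c).2.2)) := by
  have hval : j.rep j.base = j.val.1 := congrArg Prod.fst j.jetInChart_rep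
  have hrep : (j.affine α β s).rep = fun z => (α * j.val.1 + β - s * j.val.1) + s * j.rep z := by
    ext z
    simp only [Jet2.affine, Jet2.rep, Prod.smul_fst, Prod.smul_snd, Submodule.coe_smul,
      _root_.smul_apply, smul_eq_mul]
    ring
  refine Prod.ext rfl ?_
  change jetInChart c (j.affine α β s).rep j.base = _
  rw [hrep, jetInChart_smul_add_const _ _ hj j.contMDiffAt_rep, hval]
  refine Prod.ext ?_ rfl
  change _ = α * j.rep j.base + β
  rw [hval]
  ring

theorem Jet2.continuous_affine (α β s : ℝ) :
    Continuous (Jet2.affine α β s : Jet2 E X → Jet2 E X) := by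
  refine continuous_generateFrom_iff.2 ?_
  rintro _ ⟨c, V, hV, rfl⟩
  let m : E × JetFibre E → E × JetFibre E := fun q => (q.1, (α * q.2.1 + β, s • q.2.2))
  have hm : Continuous m := by
    refine continuous_fst.prodMk (Continuous.prodMk ?_ ?_)
    · exact (continuous_const.mul (continuous_fst.comp continuous_snd)).add continuous_const
    · exact Continuous.const_smul (continuous_snd.comp continuous_snd) s
  convert Jet2.isOpen_chart c (hV.preimage hm) using 1
  ext j
  refine and_congr_right fun hj => ?_
  rw [Jet2.coord_affine α β s (j := j) hj]
  rfl

theorem Jet2.continuous_neg : Continuous (Jet2.neg : Jet2 E X → Jet2 E X) := by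
  have : (Jet2.neg : Jet2 E X → Jet2 E X) = Jet2.affine (-1) 0 (-1) := by
    ext1 j; exact j.neg_eq_affine
  rw [this]
  exact Jet2.continuous_affine _ _ _

theorem Jet2.continuous_toRed : Continuous (Jet2.toRed : Jet2 E X → RedJet2 E X) := by
  refine continuous_induced_rng.2 ?_
  have : (RedJet2.withValue 0 ∘ Jet2.toRed : Jet2 E X → Jet2 E X) = Jet2.affine 0 0 1 := by
    ext1 j
    refine Jet2.ext rfl (Prod.ext (by simp [Jet2.affine, RedJet2.withValue]) ?_)
    exact (one_smul ℝ j.val.2).symm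
  rw [this]
  exact Jet2.continuous_affine _ _ _

/-- The jets of `f + s g + r` depend continuously on the point and on the parameters. -/
theorem tendsto_jet2_add {f g : X → ℝ} {x : X} (hf : ContMDiffAt 𝓘(ℝ, E) 𝓘(ℝ, ℝ) 2 f x)
    (hg : ContMDiffAt 𝓘(ℝ, E) 𝓘(ℝ, ℝ) 2 g x) :
    Tendsto (fun q : X × ℝ × ℝ => jet2 (E := E) (fun z => q.2.2 + (f z + q.2.1 * g z)) q.1)
      (𝓝 (x, 0, 0)) (𝓝 (jet2 f x)) := by
  refine TopologicalSpace.tendsto_nhds_generateFrom_iff.2 ?_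
  rintro _ ⟨c, V, hV, rfl⟩ ⟨hx, hxV⟩
  change x ∈ (chartAt E c).source at hx
  have hfst : Tendsto (fun q : X × ℝ × ℝ => q.1) (𝓝 (x, 0, 0)) (𝓝 x) := continuousAt_fst
  have hsrc : ∀ᶠ q : X × ℝ × ℝ in 𝓝 (x, 0, 0), q.1 ∈ (chartAt E c).source :=
    hfst.eventually ((chartAt E c).open_source.mem_nhds hx)
  have hev : ∀ᶠ q : X × ℝ × ℝ in 𝓝 (x, 0, 0),
      (jet2 (E := E) (fun z => q.2.2 + (f z + q.2.1 * g z)) q.1).coord c =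
        (extChartAt 𝓘(ℝ, E) c q.1, (jetInChart c f q.1 + q.2.1 • jetInChart c g q.1)
          + (q.2.2, 0)) := by
    filter_upwards [hsrc, hfst.eventually (contMDiffAt_two_eventually hf),
      hfst.eventually (contMDiffAt_two_eventually hg)] with q h1 h2 h3
    have h4 : ContMDiffAt 𝓘(ℝ, E) 𝓘(ℝ, ℝ) 2 (fun z => f z + q.2.1 * g z) q.1 :=
      h2.add (contMDiffAt_const.mul h3)
    have h5 : ContMDiffAt 𝓘(ℝ, E) 𝓘(ℝ, ℝ) 2
        (fun z => q.2.2 + (f z + q.2.1 * g z)) q.1 :=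
      contMDiffAt_const.add h4
    have h6 := jetInChart_smul_add_const 1 q.2.2 h1 h4
    simp only [one_mul] at h6
    rw [coord_jet2 h1 h5, h6]
    refine Prod.ext rfl (Prod.ext ?_ ?_)
    · change q.2.2 + (f q.1 + q.2.1 * g q.1) = (f q.1 + q.2.1 * g q.1) + q.2.2
      ring
    · rw [jetInChart_add_smul _ h1 h2 h3]
      exact (one_smul ℝ _).trans (add_zero _).symm
  have hlim : Tendsto (fun q : X × ℝ × ℝ => (extChartAt 𝓘(ℝ, E) c q.1,
      (jetInChart (E := E) c f q.1 + q.2.1 • jetInChart c g q.1) + ((q.2.2, 0) : JetFibre E)))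
      (𝓝 (x, 0, 0)) (𝓝 (extChartAt 𝓘(ℝ, E) c x, jetInChart c f x)) := by
    have a1 : Tendsto (fun q : X × ℝ × ℝ => extChartAt 𝓘(ℝ, E) c q.1) (𝓝 (x, 0, 0))
        (𝓝 (extChartAt 𝓘(ℝ, E) c x)) :=
      Tendsto.comp (continuousAt_extChartAt' (by simpa using hx)) hfst
    have a2 := Tendsto.comp (continuousAt_jetInChart hx hf) hfst
    have a3 := Tendsto.comp (continuousAt_jetInChart hx hg) hfst
    have a4 : Tendsto (fun q : X × ℝ × ℝ => q.2.1) (𝓝 (x, 0, 0)) (𝓝 0) :=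
      (continuous_fst.comp continuous_snd).continuousAt
    have a5 : Tendsto (fun q : X × ℝ × ℝ => ((q.2.2, 0) : JetFibre E)) (𝓝 (x, 0, 0))
        (𝓝 (0, 0)) :=
      Tendsto.prodMk_nhds (continuous_snd.comp continuous_snd).continuousAt tendsto_const_nhds
    have a6 := a1.prodMk_nhds ((a2.add (Tendsto.smul a4 a3)).add a5)
    have e : jetInChart (E := E) c f x + (0 : ℝ) • jetInChart c g x + ((0, 0) : JetFibre E) =
        jetInChart c f x := by
      refine (add_zero _).trans ?_
      exact (congrArg (_ + ·) (zero_smul ℝ _)).trans (add_zero _)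
    rw [e] at a6
    exact a6
  rw [coord_jet2 hx hf] at hxV
  filter_upwards [hsrc, hev, hlim (hV.mem_nhds hxV)] with q h1 h2 h3
  refine ⟨h1, ?_⟩
  rwa [h2]

theorem jet2_smul_add_const {f : X → ℝ} {x : X} (s r : ℝ)
    (hf : ContMDiffAt 𝓘(ℝ, E) 𝓘(ℝ, ℝ) 2 f x) :
    jet2 (E := E) (fun z => r + s * f z) x =
      ⟨x, (r + s * f x, s • (jetInChart x f x).2)⟩ :=
  Jet2.ext rfl (jetInChart_smul_add_const s r (mem_chart_source E x) hf)

theorem jet2_neg {f : X → ℝ} {x : X} (hf : ContMDiffAt 𝓘(ℝ, E) 𝓘(ℝ, ℝ) 2 f x) :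
    jet2 (E := E) (fun z => -f z) x = (jet2 f x).neg := by
  have h := jet2_smul_add_const (-1) 0 hf
  simp only [neg_one_mul, zero_add] at h
  rw [h]
  exact Jet2.ext rfl (Prod.ext rfl (neg_one_smul ℝ (jetInChart (E := E) x f x).2))

/-- Positivity in terms of functions: if `f ≤ ψ` near `x`, with equality at `x`, and the jet of
`f` lies in `F`, then so does the jet of `ψ`. -/
theorem jet2_mem_of_le {F : Set (Jet2 E X)}
    (hpos : ∀ (x : X) (r : ℝ) (p : E →L[ℝ] ℝ) (A P : SymForm E),
      (∀ v, 0 ≤ (P : E →L[ℝ] E →L[ℝ] ℝ) v v) →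
      (⟨x, (r, p, A)⟩ : Jet2 E X) ∈ F → (⟨x, (r, p, A + P)⟩ : Jet2 E X) ∈ F)
    {f ψ : X → ℝ} {x : X}
    (hf : ContMDiffAt 𝓘(ℝ, E) 𝓘(ℝ, ℝ) 2 f x) (hψ : ContMDiffAt 𝓘(ℝ, E) 𝓘(ℝ, ℝ) 2 ψ x)
    (hle : ∀ᶠ z in 𝓝 x, f z ≤ ψ z) (heq : f x = ψ x) (hF : jet2 f x ∈ F) : jet2 ψ x ∈ F := by
  have hx := mem_chart_source E x
  set d : X → ℝ := fun z => ψ z + (-1) * f z with hd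
  have hdc : ContMDiffAt 𝓘(ℝ, E) 𝓘(ℝ, ℝ) 2 d x := hψ.add (contMDiffAt_const.mul hf)
  have hdj : jetInChart (E := E) x d x = jetInChart x ψ x + (-1 : ℝ) • jetInChart x f x :=
    jetInChart_add_smul _ hx hψ hf
  have hinv : (extChartAt 𝓘(ℝ, E) x).symm (extChartAt 𝓘(ℝ, E) x x) = x :=
    extChartAt_to_inv x
  have hmin : IsLocalMin (inChart (E := E) x d) (extChartAt 𝓘(ℝ, E) x x) := by
    have hc : Tendsto (extChartAt 𝓘(ℝ, E) x).symm (𝓝 (extChartAt 𝓘(ℝ, E) x x)) (𝓝 x) := by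
      have := continuousAt_extChartAt_symm (I := 𝓘(ℝ, E)) x
      rwa [ContinuousAt, hinv] at this
    filter_upwards [hc.eventually hle] with y hy
    simp only [inChart, hinv, d, heq]
    linarith
  have h1 : (jetInChart (E := E) x d x).2.1 = 0 := hmin.fderiv_eq_zero
  have h2 : ∀ v, 0 ≤ ((jetInChart (E := E) x d x).2.2 : E →L[ℝ] E →L[ℝ] ℝ) v v := by
    intro v
    rw [coe_jetInChart_snd hx hdc]
    exact second_deriv_nonneg_of_isLocalMin (contDiffAt_inChart hx hdc) hmin v
  have e : jetInChart (E := E) x ψ x = jetInChart x f x + jetInChart x d x := by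
    rw [hdj]
    have : (-1 : ℝ) • jetInChart (E := E) x f x = - jetInChart x f x :=
      neg_one_smul ℝ (jetInChart (E := E) x f x)
    rw [this]
    abel
  have key := hpos x (f x) (jetInChart (E := E) x f x).2.1 (jetInChart (E := E) x f x).2.2
    (jetInChart (E := E) x d x).2.2 h2 hF
  convert key using 1
  refine Jet2.ext rfl (Prod.ext heq.symm (Prod.ext ?_ ?_))
  · change (jetInChart (E := E) x ψ x).2.1 = _
    rw [e]
    exact (congrArg (_ + ·) h1).trans (add_zero _)
  · change (jetInChart (E := E) x ψ x).2.2 = _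
    rw [e]
    rfl

end JetTopology

/-! ### Duality and scaled jets. -/

section Duality

variable {E : Type*} [NormedAddCommGroup E] [NormedSpace ℝ E]
  {X : Type*}

/-- The negativity condition `F + 𝒩 ⊆ F`. -/
def IsNegative (F : Set (Jet2 E X)) : Prop :=
  ∀ (x : X) (r s : ℝ) (q : RedFibre E), s ≤ 0 →
    (⟨x, (r, q)⟩ : Jet2 E X) ∈ F → (⟨x, (r + s, q)⟩ : Jet2 E X) ∈ F

theorem IsNegative.mono {F : Set (Jet2 E X)} (hF : IsNegative F) {x : X} {r r' : ℝ}
    {q : RedFibre E} (h : r' ≤ r) (hr : (⟨x, (r, q)⟩ : Jet2 E X) ∈ F) :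
    (⟨x, (r', q)⟩ : Jet2 E X) ∈ F := by
  have := hF x r (r' - r) q (by linarith) hr
  rwa [add_sub_cancel] at this

variable [TopologicalSpace X] [ChartedSpace E X]

/-- `F` avoids the negatives of the interior points of `F'`; this relates a subequation and its
dual symmetrically. -/
def Opposed (F F' : Set (Jet2 E X)) : Prop := ∀ j ∈ F, j.neg ∉ interior F'

theorem dual_opposed (F : Set (Jet2 E X)) : Opposed (dual F) F := fun _ hj => hj

variable [IsManifold 𝓘(ℝ, E) ∞ X]

/-- If `-j` were interior to the dual, the same would hold near `j`, in particular at some interior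
point of `F`, against the definition of the dual. The reversed pair is `dual_opposed`, so later
arguments serve `F` and its dual alike. -/
theorem opposed_dual {F : Set (Jet2 E X)} (hF : F = closure (interior F)) :
    Opposed F (dual F) := by
  intro j hj hint
  rw [hF] at hj
  have hopen : IsOpen (Jet2.neg ⁻¹' interior (dual F)) :=
    isOpen_interior.preimage Jet2.continuous_neg
  obtain ⟨j', h1, h2⟩ := mem_closure_iff.1 hj _ hopen hint
  have h3 : j'.neg ∈ dual F := interior_subset h1
  exact h3 (by rwa [Jet2.neg_neg])

/-- Lowering the value preserves not only `F` but also its interior, because the shifts of the jet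
bundle are continuous; negation then gives the claim. -/
theorem IsNegative.dual {F : Set (Jet2 E X)} (hF : IsNegative F) : IsNegative (dual F) := by
  intro x r s q hs hj hint
  apply hj
  have hopen : IsOpen (Jet2.affine 1 (-s) 1 ⁻¹' interior F) :=
    isOpen_interior.preimage (Jet2.continuous_affine _ _ _)
  have hsub : Jet2.affine 1 (-s) 1 ⁻¹' interior F ⊆ F := by
    intro j hj
    have h1 : j.affine 1 (-s) 1 ∈ F := interior_subset hj
    have h2 : (⟨j.base, (j.val.1 - s, j.val.2)⟩ : Jet2 E X) ∈ F := by
      convert h1 using 1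
      refine Jet2.ext rfl (Prod.ext ?_ (one_smul ℝ j.val.2).symm)
      simp [Jet2.affine, sub_eq_add_neg]
    exact hF.mono (r := j.val.1 - s) (by linarith) h2
  refine interior_maximal hsub hopen ?_
  have e : (Jet2.neg ⟨x, (r, q)⟩ : Jet2 E X).affine 1 (-s) 1 = Jet2.neg ⟨x, (r + s, q)⟩ := by
    refine Jet2.ext rfl (Prod.ext ?_ (one_smul ℝ (-q)))
    simp [Jet2.affine, Jet2.neg]
    ring
  rw [mem_preimage, e]
  exact hint

/-- The negative of this jet has value below `l` and reduced part `t` times a jet in `N`. Such jets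
form an open set, contained in `F'` by `hNt` and negativity. Hence `c - t * h` cannot be a test
function at `z` for an `F`-subharmonic function. -/
theorem Opposed.jet2_notMem {F F' : Set (Jet2 E X)} (hFF' : Opposed F F') (hF' : IsNegative F')
    {N : Set (RedJet2 E X)} (hN : IsOpen N) {l t : ℝ} (ht : 0 < t)
    (hNt : ∀ J ∈ N, J.scale t ∈ fixValue F' l) {h : X → ℝ} {z : X}
    (hh : ContMDiffAt 𝓘(ℝ, E) 𝓘(ℝ, ℝ) 2 h z) (hz : redJet2 h z ∈ N) {c : ℝ}
    (hc : -l < c - t * h z) : jet2 (fun y => c - t * h y) z ∉ F := by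
  intro hmem
  have hred : ∀ q : RedFibre E, t • t⁻¹ • q = q := fun q => smul_inv_smul₀ ht.ne' q
  set O : Set (Jet2 E X) := {j | j.val.1 < l ∧ (j.affine 1 0 t⁻¹).toRed ∈ N} with hO
  have hopen : IsOpen O :=
    (isOpen_lt Jet2.continuous_value continuous_const).inter
      (hN.preimage (Jet2.continuous_toRed.comp (Jet2.continuous_affine _ _ _)))
  have hsub : O ⊆ F' := by
    rintro j ⟨h1, h2⟩
    have h3 : (⟨j.base, (l, t • t⁻¹ • j.val.2)⟩ : Jet2 E X) ∈ F' := hNt _ h2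
    rw [hred] at h3
    exact hF'.mono h1.le h3
  refine hFF' _ hmem (interior_maximal hsub hopen ?_)
  have e := jet2_smul_add_const (E := E) (-t) c hh
  simp only [neg_mul, ← sub_eq_add_neg] at e
  rw [e]
  constructor
  · change -(c - t * h z) < l
    linarith
  · convert hz using 1
    refine RedJet2.ext rfl ?_
    change t⁻¹ • (-(-t • (jetInChart (E := E) z h z).2)) = _
    have h1 : -t • (jetInChart (E := E) z h z).2 = -(t • (jetInChart (E := E) z h z).2) :=
      neg_smul t (jetInChart (E := E) z h z).2
    rw [h1, _root_.neg_neg]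
    exact inv_smul_smul₀ ht.ne' _

/-- The counterpart for lower barriers: `c + t * h` has its jet in `F` wherever its value is at most
the level `l`. -/
theorem IsNegative.jet2_mem {F : Set (Jet2 E X)} (hF : IsNegative F)
    {l t : ℝ} {h : X → ℝ} {z : X} (hh : ContMDiffAt 𝓘(ℝ, E) 𝓘(ℝ, ℝ) 2 h z)
    (hz : (redJet2 h z).scale t ∈ fixValue F l) {c : ℝ}
    (hc : c + t * h z ≤ l) : jet2 (fun y => c + t * h y) z ∈ F := by
  rw [jet2_smul_add_const t c hh]
  exact hF.mono hc hz

end Duality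

/-! ### Local perturbations and peaking barriers. -/

section Barriers

variable {E : Type*} [NormedAddCommGroup E] [NormedSpace ℝ E]
  {X : Type*} [TopologicalSpace X] [ChartedSpace E X]

/-- A peaking barrier at the boundary point `x`: a function on a compact neighbourhood `B` of `x`
which vanishes at `x`, is negative at the other points of `closure Ω`, and whose reduced jets,
scaled by large factors, lie in the reduced subequation at level `l`, stably. -/
structure IsBarrier (F : Set (Jet2 E X)) (l : ℝ) (Ω : Set X) (x : X) (B : Set X) (h : X → ℝ)
    (t₀ : ℝ) (N : Set (RedJet2 E X)) : Prop where
  compact : IsCompact B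
  mem_nhds : B ∈ 𝓝 x
  contMDiffAt : ∀ z ∈ B, ContMDiffAt 𝓘(ℝ, E) 𝓘(ℝ, ℝ) 2 h z
  eq_zero : h x = 0
  neg : ∀ z ∈ B, z ∈ closure Ω → z ≠ x → h z < 0
  t₀_pos : 0 < t₀
  isOpen : IsOpen N
  redJet2_mem : ∀ z ∈ B, redJet2 h z ∈ N
  scale_mem : ∀ t ≥ t₀, ∀ J ∈ N, J.scale t ∈ fixValue F l

theorem IsBarrier.continuousOn {F : Set (Jet2 E X)} {l : ℝ} {Ω : Set X} {x : X} {B : Set X}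
    {h : X → ℝ} {t₀ : ℝ} {N : Set (RedJet2 E X)} (hb : IsBarrier F l Ω x B h t₀ N) :
    ContinuousOn h B := fun z hz => (hb.contMDiffAt z hz).continuousAt.continuousWithinAt

theorem IsBarrier.nonpos {F : Set (Jet2 E X)} {l : ℝ} {Ω : Set X} {x : X} {B : Set X}
    {h : X → ℝ} {t₀ : ℝ} {N : Set (RedJet2 E X)} (hb : IsBarrier F l Ω x B h t₀ N)
    {z : X} (hz : z ∈ B) (hzΩ : z ∈ closure Ω) : h z ≤ 0 := by
  by_cases hzx : z = x
  · rw [hzx, hb.eq_zero]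
  · exact (hb.neg z hz hzΩ hzx).le

variable [FiniteDimensional ℝ E]

/-- The squared Euclidean distance to `x` in the preferred chart at `x`. -/
def chartDistSq (x z : X) : ℝ :=
  ‖toEuclidean (extChartAt 𝓘(ℝ, E) x z - extChartAt 𝓘(ℝ, E) x x)‖ ^ 2

theorem chartDistSq_self (x : X) : chartDistSq (E := E) x x = 0 := by simp [chartDistSq]

theorem chartDistSq_pos {x z : X} (hz : z ∈ (chartAt E x).source) (hzx : z ≠ x) :
    0 < chartDistSq (E := E) x z := by
  have hne : extChartAt 𝓘(ℝ, E) x z ≠ extChartAt 𝓘(ℝ, E) x x := fun h =>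
    hzx ((extChartAt 𝓘(ℝ, E) x).injOn (by simpa using hz) (by simp) h)
  have : toEuclidean (extChartAt 𝓘(ℝ, E) x z - extChartAt 𝓘(ℝ, E) x x) ≠ 0 := by
    intro h
    exact hne (sub_eq_zero.1 (toEuclidean.map_eq_zero_iff.1 h))
  exact pow_pos (norm_pos_iff.2 this) 2

variable [IsManifold 𝓘(ℝ, E) ∞ X]

/-- The norm of `E` need not have a smooth square; `toEuclidean` in the definition provides one that
does. -/
theorem contMDiffAt_chartDistSq {x z : X} (hz : z ∈ (chartAt E x).source) :
    ContMDiffAt 𝓘(ℝ, E) 𝓘(ℝ, ℝ) 2 (chartDistSq (E := E) x) z := by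
  have : IsManifold 𝓘(ℝ, E) 2 X := isManifold_two
  have h1 : ContMDiffAt 𝓘(ℝ, E) 𝓘(ℝ, E) 2 (extChartAt 𝓘(ℝ, E) x) z := contMDiffAt_extChartAt' hz
  have h2 : ContDiff ℝ 2 (fun y : E => ‖toEuclidean (y - extChartAt 𝓘(ℝ, E) x x)‖ ^ 2) :=
    ContDiff.norm_sq ℝ (toEuclidean.contDiff.comp (contDiff_id.sub contDiff_const))
  exact h2.contMDiff.contMDiffAt.comp z h1

/-- The edge of `B` is compact and misses `x`. The resulting gap forces perturbed maxima into the
interior of `B`. -/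
theorem exists_chartDistSq_ge {B : Set X} (hB : IsCompact B) {x : X} (hxB : B ∈ 𝓝 x)
    (hBs : B ⊆ (chartAt E x).source) :
    ∃ μ > 0, ∀ z ∈ B \ interior B, μ ≤ chartDistSq (E := E) x z := by
  refine (hB.diff isOpen_interior).exists_forall_le' (f := chartDistSq (E := E) x) (a := 0)
    (fun z hz => (contMDiffAt_chartDistSq (hBs hz.1)).continuousAt.continuousWithinAt)
    fun z hz => chartDistSq_pos (hBs hz.1) fun e => hz.2 ?_
  rw [e]
  exact mem_interior_iff_mem_nhds.2 hxB

/-- If the jet of `f` at `x` lies in an open set, then so do the jets at nearby points of all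
small perturbations of `f` by multiples of the squared distance to `x` and by constants. -/
theorem exists_perturbation [LocallyCompactSpace X] {f : X → ℝ} {x : X}
    (hf : ContMDiffAt 𝓘(ℝ, E) 𝓘(ℝ, ℝ) 2 f x)
    {O : Set X} (hO : O ∈ 𝓝 x) {N : Set (Jet2 E X)} (hN : N ∈ 𝓝 (jet2 f x)) :
    ∃ B ⊆ O, IsCompact B ∧ B ∈ 𝓝 x ∧ B ⊆ (chartAt E x).source ∧ ∃ δ₀ > 0,
      (∀ δ, ∀ z ∈ B,
        ContMDiffAt 𝓘(ℝ, E) 𝓘(ℝ, ℝ) 2 (fun y => f y + δ * chartDistSq (E := E) x y) z) ∧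
      ∀ z ∈ B, ∀ δ s, |δ| < δ₀ → |s| < δ₀ →
        jet2 (fun y => s + (f y + δ * chartDistSq (E := E) x y)) z ∈ N := by
  have hd := contMDiffAt_chartDistSq (E := E) (mem_chart_source E x)
  have h := tendsto_jet2_add hf hd hN
  rw [mem_map, nhds_prod_eq, nhds_prod_eq] at h
  obtain ⟨V, hV, W, hW, hVW⟩ := mem_prod_iff.1 h
  obtain ⟨W₁, hW₁, W₂, hW₂, hW12⟩ := mem_prod_iff.1 hW
  obtain ⟨δ₀, hδ₀, hδW⟩ := Metric.mem_nhds_iff.1 (inter_mem hW₁ hW₂)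
  have hS : O ∩ V ∩ (chartAt E x).source ∩
      {z | ContMDiffAt 𝓘(ℝ, E) 𝓘(ℝ, ℝ) 2 f z} ∈ 𝓝 x :=
    inter_mem (inter_mem (inter_mem hO hV)
      ((chartAt E x).open_source.mem_nhds (mem_chart_source E x))) (contMDiffAt_two_eventually hf)
  obtain ⟨B, hBn, hBS, hBc⟩ := LocallyCompactSpace.local_compact_nhds x _ hS
  refine ⟨B, fun z hz => (hBS hz).1.1.1, hBc, hBn, fun z hz => (hBS hz).1.2, δ₀, hδ₀, ?_, ?_⟩
  · intro δ z hz
    exact (hBS hz).2.add (contMDiffAt_const.mul (contMDiffAt_chartDistSq (hBS hz).1.2))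
  · intro z hz δ s hδ hs
    have hmem : (z, δ, s) ∈ V ×ˢ W :=
      ⟨(hBS hz).1.1.2, hW12 ⟨(hδW (by simpa using hδ)).1, (hδW (by simpa using hs)).2⟩⟩
    exact hVW hmem

/-- A small multiple of the squared distance to `x` is subtracted from the defining function. This
makes `x` the only zero in `closure Ω` near `x`, and the reduced jets stay in the open set `N`
provided by the asymptotic interior. -/
theorem RedStrictlyConvexAt.exists_isBarrier [LocallyCompactSpace X] {F : Set (Jet2 E X)} {l : ℝ}
    {Ω : Set X} {x : X} (hx : x ∈ frontier Ω) (hconv : RedStrictlyConvexAt (fixValue F l) Ω x)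
    {O : Set X} (hO : O ∈ 𝓝 x) :
    ∃ B ⊆ O, ∃ h t₀ N, IsBarrier F l Ω x B h t₀ N := by
  obtain ⟨U, ρ, hU, hxU, hρ, hjet⟩ := hconv
  obtain ⟨N, hN, t₀, ht₀, hNt⟩ := hjet x hxU
  have hρ2 : ContMDiffAt 𝓘(ℝ, E) 𝓘(ℝ, ℝ) 2 ρ x :=
    ((hρ.smooth x hxU).contMDiffAt (hU.mem_nhds hxU)).of_le (by decide)
  obtain ⟨B, hBO, hBc, hBn, hBs, δ₀, hδ₀, hc, hj⟩ :=
    exists_perturbation hρ2 (inter_mem hO (hU.mem_nhds hxU)) (N := Jet2.toRed ⁻¹' interior N)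
      (Jet2.continuous_toRed.continuousAt.preimage_mem_nhds (interior_mem_nhds.2 hN))
  refine ⟨B, fun z hz => (hBO hz).1, fun y => ρ y + -(δ₀ / 2) * chartDistSq (E := E) x y, t₀,
    interior N, hBc, hBn, hc _, ?_, ?_, ht₀, isOpen_interior, ?_, ?_⟩
  · simp only [chartDistSq_self, (hρ.zero_iff x hxU).2 hx, mul_zero, add_zero]
  · intro z hz hzΩ hzx
    have h1 : ρ z ≤ 0 := by
      rw [closure_eq_self_union_frontier] at hzΩ
      rcases hzΩ with h | h
      · exact (hρ.neg z (hBO hz).2 h).le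
      · exact ((hρ.zero_iff z (hBO hz).2).2 h).le
    have h2 := mul_pos (half_pos hδ₀) (chartDistSq_pos (hBs hz) hzx)
    linarith
  · intro z hz
    have := hj z hz (-(δ₀ / 2)) 0 (by rw [abs_neg, abs_of_pos (half_pos hδ₀)]; linarith)
      (by simpa using hδ₀)
    simp only [zero_add] at this
    exact this
  · exact fun t ht J hJ => hNt t ht J (interior_subset hJ)

end Barriers

/-! ### Invariance of the dual. -/

section Invariance

variable {E : Type*} [NormedAddCommGroup E] [NormedSpace ℝ E] [FiniteDimensional ℝ E]
  {X : Type*} [TopologicalSpace X] [ChartedSpace E X] [IsManifold 𝓘(ℝ, E) ∞ X]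
  {G : Type*} [Group G] [MulAction G X]

/-- The jet of `f ∘ Φ` at `y` depends continuously on the jet of `f` at `Φ y`. -/
theorem continuous_jetInChart_comp {Φ : X → X} {x y : X} (hxy : Φ y = x)
    (hΦ : ContMDiffAt 𝓘(ℝ, E) 𝓘(ℝ, E) 2 Φ y) :
    Continuous fun v : JetFibre E =>
      jetInChart (E := E) y (fun z => (⟨x, v⟩ : Jet2 E X).rep (Φ z)) y := by
  subst hxy
  set L := fun v : JetFibre E =>
      jetInChart (E := E) y (fun z => (⟨Φ y, v⟩ : Jet2 E X).rep (Φ z)) y with hL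
  -- The representative depends linearly on the jet, so the pull-back is a linear map of a
  -- finite-dimensional space and is automatically continuous.
  have key : ∀ (v w : JetFibre E) (s : ℝ), L (v + s • w) = L v + s • L w := by
    intro v w s
    have hv := (⟨Φ y, v⟩ : Jet2 E X).contMDiffAt_rep.comp y hΦ
    have hw := (⟨Φ y, w⟩ : Jet2 E X).contMDiffAt_rep.comp y hΦ
    have h := jetInChart_add_smul s (mem_chart_source E y) hv hw
    refine Eq.trans (congrArg (fun f => jetInChart (E := E) y f y) ?_) h
    ext z
    simp only [Jet2.rep, Function.comp, Prod.fst_add, Prod.snd_add, Prod.smul_fst, Prod.smul_snd,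
      Submodule.coe_add, Submodule.coe_smul, _root_.add_apply, _root_.smul_apply, smul_eq_mul]
    ring
  have hadd : ∀ v w, L (v + w) = L v + L w := by
    intro v w
    have h := key v w 1
    have e1 : (1 : ℝ) • w = w := one_smul ℝ w
    have e2 : (1 : ℝ) • L w = L w := one_smul ℝ (L w)
    rwa [e1, e2] at h
  have h0 : L 0 = 0 := by
    have := hadd 0 0
    rw [add_zero] at this
    exact left_eq_add.1 this
  have hsmul : ∀ (s : ℝ) v, L (s • v) = s • L v := by
    intro s v
    have h := key 0 v s
    rwa [zero_add, h0, zero_add] at h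
  let L' : JetFibre E →ₗ[ℝ] JetFibre E := { toFun := L, map_add' := hadd, map_smul' := hsmul }
  exact L'.continuous_of_finiteDimensional

/-- The dual of an invariant subequation is invariant. -/
theorem IsJetInvariant.dual {F : Set (Jet2 E X)} (hF : IsSubequation F)
    (hinv : IsJetInvariant G F)
    (hsm : ∀ a : G, ContMDiff 𝓘(ℝ, E) 𝓘(ℝ, E) 2 (fun z : X => a • z)) :
    IsJetInvariant G (dual F) := by
  intro a x f hf hfx hmem
  apply hfx
  have hax : a⁻¹ • a • x = x := inv_smul_smul a x
  have hnf : ContMDiffAt 𝓘(ℝ, E) 𝓘(ℝ, ℝ) 2 (fun z => -f z) x := hf.neg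
  have hfa : ContMDiffAt 𝓘(ℝ, E) 𝓘(ℝ, ℝ) 2 (fun z => f (a⁻¹ • z)) (a • x) :=
    ContMDiffAt.comp (g := f) (a • x) (by rwa [hax]) (hsm a⁻¹ (a • x))
  set L := fun v : JetFibre E =>
    jetInChart (E := E) (a • x) (fun z => (⟨x, v⟩ : Jet2 E X).rep (a⁻¹ • z)) (a • x) with hL
  have hLc : Continuous L := continuous_jetInChart_comp hax (hsm a⁻¹ (a • x))
  -- Acting by `a⁻¹` brings the pulled-back jet back to `v`. Continuity on a single fibre suffices,
  -- since the interior of a fibre of `F` is the fibre of the interior.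
  have hsub : L ⁻¹' interior (fibre F (a • x)) ⊆ fibre F x := by
    intro v hv
    have h1 : jet2 (fun z => (⟨x, v⟩ : Jet2 E X).rep (a⁻¹ • z)) (a • x) ∈ F :=
      interior_subset (s := fibre F (a • x)) hv
    have hrep : ContMDiffAt 𝓘(ℝ, E) 𝓘(ℝ, ℝ) 2
        (fun z => (⟨x, v⟩ : Jet2 E X).rep (a⁻¹ • z)) (a • x) :=
      ContMDiffAt.comp (g := (⟨x, v⟩ : Jet2 E X).rep) (a • x)
        (by rw [hax]; exact (⟨x, v⟩ : Jet2 E X).contMDiffAt_rep) (hsm a⁻¹ (a • x))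
    have h2 := hinv a⁻¹ (a • x) _ hrep h1
    simp only [inv_inv, inv_smul_smul] at h2
    have h3 := jet2_rep (⟨x, v⟩ : Jet2 E X)
    change (⟨x, v⟩ : Jet2 E X) ∈ F
    rw [← h3]
    exact h2
  have hopen : IsOpen (L ⁻¹' interior (fibre F (a • x))) := isOpen_interior.preimage hLc
  have hv : (jet2 (fun z => -f z) x).val ∈ L ⁻¹' interior (fibre F (a • x)) := by
    rw [mem_preimage, hF.interior_fibre]
    change (⟨a • x, L (jet2 (fun z => -f z) x).val⟩ : Jet2 E X) ∈ interior F
    rw [← jet2_neg hfa] at hmem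
    convert hmem using 1
    refine Jet2.ext rfl ?_
    refine jetInChart_comp_congr (c := x) (Φ := fun z : X => a⁻¹ • z)
      (f := (jet2 (E := E) (fun z => -f z) x).rep) (g := fun z => -f z)
      (hsm a⁻¹ (a • x)) ?_ ?_ ?_ (mem_chart_source E _) ?_
    · rw [hax]; exact (jet2 (E := E) (fun z => -f z) x).contMDiffAt_rep
    · rwa [hax]
    · rw [hax]; exact mem_chart_source E x
    · rw [hax]; exact (jet2 (E := E) (fun z => -f z) x).jetInChart_rep
  have := interior_maximal hsub hopen hv
  rw [hF.interior_fibre] at this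
  rw [← jet2_neg hf]
  exact this

end Invariance

/-! ### Test functions and the asymptotic maximum set. -/

section Touching

variable {E : Type*} [NormedAddCommGroup E] [NormedSpace ℝ E]
  {X : Type*} [TopologicalSpace X] [ChartedSpace E X]

/-- The jets at `x` of all `C²` functions touching `u` from above at `x` lie in `F`. -/
def IsSubharmonicAt (F : Set (Jet2 E X)) (u : X → ℝ) (x : X) : Prop :=
  ∀ ψ : X → ℝ, ContMDiffAt 𝓘(ℝ, E) 𝓘(ℝ, ℝ) 2 ψ x → (∀ᶠ z in 𝓝 x, u z ≤ ψ z) → u x = ψ x →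
    jet2 ψ x ∈ F

theorem IsSubharmonicAt.comp_smul {G : Type*} [Group G] [MulAction G X] {F : Set (Jet2 E X)}
    (hinv : IsJetInvariant G F)
    (hsm : ∀ a : G, ContMDiff 𝓘(ℝ, E) 𝓘(ℝ, E) 2 (fun z : X => a • z))
    {u : X → ℝ} {a : G} {x : X} (h : IsSubharmonicAt F u (a • x)) :
    IsSubharmonicAt F (fun z => u (a • z)) x := by
  intro ψ hψ hle heq
  have hax : a⁻¹ • a • x = x := inv_smul_smul a x
  have hc : ContMDiffAt 𝓘(ℝ, E) 𝓘(ℝ, ℝ) 2 (fun z => ψ (a⁻¹ • z)) (a • x) :=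
    ContMDiffAt.comp (g := ψ) (a • x) (by rwa [hax]) (hsm a⁻¹ (a • x))
  have ht : Tendsto (fun z : X => a⁻¹ • z) (𝓝 (a • x)) (𝓝 x) := by
    have := (hsm a⁻¹).continuous.continuousAt (x := a • x)
    rwa [ContinuousAt, hax] at this
  have hle' : ∀ᶠ z in 𝓝 (a • x), u z ≤ ψ (a⁻¹ • z) := by
    filter_upwards [ht.eventually hle] with z hz
    simpa using hz
  have h1 := h _ hc hle' (by simpa [hax] using heq)
  have h2 := hinv a⁻¹ (a • x) _ hc h1
  simpa only [inv_inv, inv_smul_smul] using h2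

/-- The points near which the functions `v j` come close, in proportion, to their bounds `M j`. -/
def relMaxSet (K : Set X) (v : ℕ → X → ℝ) (M : ℕ → ℝ) : Set X :=
  {z | ∀ V ∈ 𝓝 z, ∀ θ < 1, ∃ᶠ j in atTop, ∃ y ∈ V ∩ K, θ * M j < v j y}

variable [IsManifold 𝓘(ℝ, E) ∞ X]

theorem IsSubharmonicAt.sub_const {F : Set (Jet2 E X)} (hF : IsNegative F) {u : X → ℝ} {x : X}
    (hu : IsSubharmonicAt F u x) {ε : ℝ} (hε : 0 ≤ ε) :
    IsSubharmonicAt F (fun z => u z - ε) x := by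
  intro ψ hψ hle heq
  have h := hu (fun z => ε + 1 * ψ z) (contMDiffAt_const.add (contMDiffAt_const.mul hψ))
    (hle.mono fun z hz => by linarith) (by linarith)
  rw [jet2_smul_add_const 1 ε hψ] at h
  have e : (1 : ℝ) • (jetInChart (E := E) x ψ x).2 = (jetInChart (E := E) x ψ x).2 :=
    one_smul ℝ _
  rw [e] at h
  exact hF.mono (by linarith) h

/-- The asymptotic maximum set of a sequence of subharmonic functions, with maxima tending to
infinity, cannot touch from inside a boundary point carrying a barrier for the dual. -/
theorem IsBarrier.notMem_relMaxSet [T2Space X] {F F' : Set (Jet2 E X)} (hopp : Opposed F F')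
    (hneg : IsNegative F') {Ω K : Set X} {x : X} {B : Set X} {h : X → ℝ} {t₀ : ℝ}
    {N : Set (RedJet2 E X)} (hb : IsBarrier F' 0 Ω x B h t₀ N) (hK : IsClosed K)
    {v : ℕ → X → ℝ} {M : ℕ → ℝ} (hv : ∀ j, UpperSemicontinuousOn (v j) K)
    (hvM : ∀ j, ∀ y ∈ K, v j y ≤ M j) (hMpos : ∀ j, 0 < M j) (hM : Tendsto M atTop atTop)
    (htest : ∀ j, ∀ y ∈ K, M j / 2 < v j y → K ∈ 𝓝 y ∧ IsSubharmonicAt F (v j) y)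
    (hZ : relMaxSet K v M ⊆ closure Ω) : x ∉ relMaxSet K v M := by
  intro hx
  have hBc : IsClosed B := hb.compact.isClosed
  have hxint : x ∈ interior B := mem_interior_iff_mem_nhds.2 hb.mem_nhds
  obtain ⟨H, hHpos, hH⟩ : ∃ H > 0, ∀ z ∈ B, |h z| ≤ H := by
    obtain ⟨H, hH⟩ := hb.compact.exists_bound_of_continuousOn hb.continuousOn
    exact ⟨max H 1, by positivity, fun z hz => (hH z hz).trans (le_max_left _ _)⟩
  -- On the edge of `B` the sum `v j + ε * M j * h` stays below `M j` by a fixed proportion. Near a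
  -- point of the asymptotic maximum set this is due to `h < 0`. Near any other point `v j ≤ θ * M
  -- j` eventually, and a small `ε` absorbs `h`, which may be positive outside `closure Ω`.
  -- Compactness combines the local bounds.
  have hBd : ∃ ε₀ > 0, ∀ ε, 0 < ε → ε ≤ ε₀ → ∃ c > 0, ∀ᶠ j in atTop, ∀ y ∈ (B \ interior B) ∩ K,
      v j y + ε * M j * h y ≤ (1 - c) * M j := by
    have hcomp : IsCompact (B \ interior B) := hb.compact.diff isOpen_interior
    refine hcomp.induction_on (p := fun S => ∃ ε₀ > 0, ∀ ε, 0 < ε → ε ≤ ε₀ → ∃ c > 0,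
      ∀ᶠ j in atTop, ∀ y ∈ S ∩ K, v j y + ε * M j * h y ≤ (1 - c) * M j) ?_ ?_ ?_ ?_
    · exact ⟨1, one_pos, fun ε _ _ => ⟨1, one_pos, by simp⟩⟩
    · rintro S T hST ⟨ε₀, h0, h1⟩
      refine ⟨ε₀, h0, fun ε e1 e2 => ?_⟩
      obtain ⟨c, hc, hev⟩ := h1 ε e1 e2
      exact ⟨c, hc, hev.mono fun j hj y hy => hj y ⟨hST hy.1, hy.2⟩⟩
    · rintro S T ⟨ε₁, h1, h1'⟩ ⟨ε₂, h2, h2'⟩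
      refine ⟨min ε₁ ε₂, lt_min h1 h2, fun ε e1 e2 => ?_⟩
      obtain ⟨c₁, hc₁, hev₁⟩ := h1' ε e1 (e2.trans (min_le_left _ _))
      obtain ⟨c₂, hc₂, hev₂⟩ := h2' ε e1 (e2.trans (min_le_right _ _))
      refine ⟨min c₁ c₂, lt_min hc₁ hc₂, ?_⟩
      filter_upwards [hev₁, hev₂] with j h3 h4 y hy
      have hm := hMpos j
      rcases hy.1 with h5 | h5
      · refine (h3 y ⟨h5, hy.2⟩).trans ?_
        have := min_le_left c₁ c₂
        gcongr
      · refine (h4 y ⟨h5, hy.2⟩).trans ?_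
        have := min_le_right c₁ c₂
        gcongr
    · intro z hz
      by_cases hzZ : z ∈ relMaxSet K v M
      · have hzx : z ≠ x := fun e => hz.2 (e ▸ hxint)
        have hneg := hb.neg z hz.1 (hZ hzZ) hzx
        have hcont := (hb.contMDiffAt z hz.1).continuousAt
        refine ⟨{y | h y < h z / 2}, mem_nhdsWithin_of_mem_nhds
          (hcont.eventually (gt_mem_nhds (by linarith))), 1, one_pos, fun ε e1 _ =>
          ⟨ε * (-h z / 2), by nlinarith, Eventually.of_forall fun j y hy => ?_⟩⟩
        have h1 := hvM j y hy.2
        have h2 : h y < h z / 2 := hy.1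
        have h3 : ε * M j * h y ≤ ε * M j * (h z / 2) :=
          mul_le_mul_of_nonneg_left h2.le (mul_pos e1 (hMpos j)).le
        linarith
      · simp only [relMaxSet, mem_ofPred_eq, not_forall, not_frequently] at hzZ
        obtain ⟨V, hV, θ, hθ, hev⟩ := hzZ
        refine ⟨V ∩ (B \ interior B),
          inter_mem (mem_nhdsWithin_of_mem_nhds hV) self_mem_nhdsWithin,
          (1 - θ) / (2 * H), div_pos (by linarith) (by positivity), fun ε e1 e2 =>
          ⟨(1 - θ) / 2, by linarith, ?_⟩⟩
        filter_upwards [hev] with j hj y hy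
        have h1 : v j y ≤ θ * M j := by
          by_contra! hcon
          exact hj ⟨y, ⟨hy.1.1, hy.2⟩, hcon⟩
        have h2 : ε * h y ≤ (1 - θ) / 2 := by
          have h3 := (le_abs_self _).trans (hH y hy.1.2.1)
          rw [le_div_iff₀ (by positivity)] at e2
          nlinarith
        have h3 := mul_le_mul_of_nonneg_left h2 (hMpos j).le
        linarith
  obtain ⟨ε₀, hε₀, hBd⟩ := hBd
  -- The bound `1 / (4 * H)` limits the barrier term to `M j / 4`, so a maximum of the sum above `3
  -- / 4 * M j` forces `v j > M j / 2`, where `htest` applies.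
  have hεpos : 0 < min ε₀ (1 / (4 * H)) := lt_min hε₀ (by positivity)
  obtain ⟨c₀, hc₀, hBd⟩ := hBd _ hεpos (min_le_left _ _)
  have hεH : min ε₀ (1 / (4 * H)) * H ≤ 1 / 4 := by
    have h1 := mul_le_mul_of_nonneg_right (min_le_right ε₀ (1 / (4 * H))) hHpos.le
    have h2 : 1 / (4 * H) * H = 1 / 4 := by field_simp
    linarith
  generalize min ε₀ (1 / (4 * H)) = ε at hεpos hBd hεH
  obtain ⟨c, hcpos, hc2, hBd⟩ : ∃ c > 0, c ≤ 1 / 2 ∧ ∀ᶠ j in atTop,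
      ∀ y ∈ (B \ interior B) ∩ K, v j y + ε * M j * h y ≤ (1 - c) * M j := by
    refine ⟨min c₀ (1 / 2), lt_min hc₀ (by norm_num), min_le_right _ _, ?_⟩
    filter_upwards [hBd] with j hj y hy
    refine (hj y hy).trans ?_
    have := min_le_left c₀ (1 / 2)
    have := hMpos j
    gcongr
  have hcontx := (hb.contMDiffAt x (interior_subset hxint)).continuousAt
  -- Near `x` the barrier costs less than `c / 4 * M j`, and some nearby `v j y` exceeds `(1 - c /
  -- 4) * M j`. Their sum beats the edge bound `(1 - c) * M j`, so the maximum over `B ∩ K` is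
  -- interior to `B`.
  have hV : interior B ∩ {y | -(c / (4 * ε)) < h y} ∈ 𝓝 x := by
    refine inter_mem (isOpen_interior.mem_nhds hxint) (hcontx.eventually (lt_mem_nhds ?_))
    rw [hb.eq_zero]
    have : 0 < c / (4 * ε) := by positivity
    linarith
  -- The barrier is scaled along with the maxima, so its factor eventually passes `t₀`.
  have hlarge : ∀ᶠ j in atTop, t₀ ≤ ε * M j := (hM.const_mul_atTop hεpos).eventually_ge_atTop t₀
  obtain ⟨j, ⟨y, ⟨⟨hyB, hyh⟩, hyK⟩, hy⟩, hjBd, hjt⟩ :=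
    ((hx _ hV (1 - c / 4) (by linarith)).and_eventually (hBd.and hlarge)).exists
  have hMj := hMpos j
  set t := ε * M j with ht
  have hty : (1 - c / 2) * M j < v j y + t * h y := by
    have h1 : -(c / (4 * ε)) < h y := hyh
    have h2 := mul_lt_mul_of_pos_left h1 (mul_pos hεpos hMj)
    have h3 : ε * M j * -(c / (4 * ε)) = -(c / 4) * M j := by field_simp
    rw [h3] at h2
    linarith
  have husc : UpperSemicontinuousOn (fun y => v j y + t * h y) (B ∩ K) :=
    ((hv j).mono inter_subset_right).add
      ((hb.continuousOn.mono inter_subset_left).const_mul t).upperSemicontinuousOn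
  obtain ⟨z, hz, hzmax⟩ :=
    husc.exists_isMaxOn (show (B ∩ K).Nonempty from ⟨y, interior_subset hyB, hyK⟩)
      (hb.compact.inter_right hK)
  obtain ⟨hzB, hzK⟩ := hz
  rw [isMaxOn_iff] at hzmax
  have hzval : (1 - c / 2) * M j < v j z + t * h z :=
    hty.trans_le (hzmax y ⟨interior_subset hyB, hyK⟩)
  have hzint : z ∈ interior B := by
    by_contra hcon
    have := hjBd z ⟨⟨hzB, hcon⟩, hzK⟩
    nlinarith
  have hvz : M j / 2 < v j z := by
    have h1 : ε * h z ≤ 1 / 4 := by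
      have := (le_abs_self _).trans (hH z hzB)
      nlinarith
    have h2 := mul_le_mul_of_nonneg_left h1 hMj.le
    have h3 : t * h z = M j * (ε * h z) := by rw [ht]; ring
    nlinarith
  obtain ⟨hKz, hsub⟩ := htest j z hzK hvz
  have hhz := hb.contMDiffAt z hzB
  have htpos : 0 < t := mul_pos hεpos hMj
  -- Level `0` suffices because `v j z > M j / 2 > 0`.
  refine hopp.jet2_notMem hneg hb.isOpen htpos (hb.scale_mem t hjt) hhz (hb.redJet2_mem z hzB)
    (c := v j z + t * h z) (by linarith) (hsub _ ?_ ?_ (by ring))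
  · exact contMDiffAt_const.sub (contMDiffAt_const.mul hhz)
  · filter_upwards [hKz, isOpen_interior.mem_nhds hzint] with w h1 h2
    have : v j w + t * h w ≤ v j z + t * h z :=
      hzmax w ⟨interior_subset h2, h1⟩
    linarith

end Touching

/-! ### The asymptotic maximum set under translations. -/

section Translation

variable {X : Type*} [TopologicalSpace X]

theorem mem_relMaxSet_comp (e : X ≃ₜ X) {K : Set X} {v : ℕ → X → ℝ} {M : ℕ → ℝ} {x : X} :
    x ∈ relMaxSet (e ⁻¹' K) (fun j z => v j (e z)) M ↔ e x ∈ relMaxSet K v M := by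
  constructor
  · intro h V hV θ hθ
    refine (h (e ⁻¹' V) (e.continuous.continuousAt hV) θ hθ).mono ?_
    rintro j ⟨y, ⟨hy1, hy2⟩, hy⟩
    exact ⟨e y, ⟨hy1, hy2⟩, hy⟩
  · intro h V hV θ hθ
    refine (h (e '' V) (e.isOpenMap.image_mem_nhds hV) θ hθ).mono ?_
    rintro j ⟨_, ⟨⟨y, hy1, rfl⟩, hy2⟩, hy⟩
    exact ⟨y, ⟨hy1, hy2⟩, hy⟩

theorem relMaxSet_subset {K : Set X} (hK : IsClosed K) (v : ℕ → X → ℝ) (M : ℕ → ℝ) :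
    relMaxSet K v M ⊆ K := by
  intro z hz
  rw [← hK.closure_eq]
  refine mem_closure_iff_nhds.2 fun V hV => ?_
  obtain ⟨j, y, hy, -⟩ := (hz V hV 0 one_pos).exists
  exact ⟨y, hy⟩

theorem isClosed_relMaxSet (K : Set X) (v : ℕ → X → ℝ) (M : ℕ → ℝ) :
    IsClosed (relMaxSet K v M) := by
  refine isClosed_of_closure_subset fun z hz V hV θ hθ => ?_
  obtain ⟨w, hwV, hw⟩ := mem_closure_iff_nhds.1 hz _ (interior_mem_nhds.2 hV)
  exact hw V (mem_interior_iff_mem_nhds.1 hwV) θ hθ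

theorem relMaxSet_nonempty {K : Set X} (hK : IsCompact K) {v : ℕ → X → ℝ} {M : ℕ → ℝ}
    (hM : ∀ j, 0 < M j) {y : ℕ → X} (hy : ∀ j, y j ∈ K) (hv : ∀ j, v j (y j) = M j) :
    (relMaxSet K v M).Nonempty := by
  obtain ⟨z, -, hz⟩ := hK.exists_mapClusterPt (f := atTop) (u := y) (by simp [hy])
  refine ⟨z, fun V hV θ hθ => ?_⟩
  refine (mapClusterPt_iff_frequently.1 hz V hV).mono fun j hj => ⟨y j, ⟨hj, hy j⟩, ?_⟩
  rw [hv]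
  have := hM j
  nlinarith

variable {G : Type*} [Group G] [TopologicalSpace G] [IsTopologicalGroup G]
  [MulAction G X] [ContinuousSMul G X]

/-- A compact subset of a domain `Ω` can be moved by the group so that it touches `∂Ω` from
inside. -/
theorem exists_smul_touching [LocallyConnectedSpace G]
    (horb : ∀ x : X, IsOpenMap fun a : G => a • x) {Ω Z : Set X} (hΩ : IsOpen Ω)
    (hconn : IsPreconnected Ω) (hfr : (frontier Ω).Nonempty) (hZ : IsCompact Z)
    (hZne : Z.Nonempty) (hZΩ : Z ⊆ Ω) :
    ∃ a : G, (∀ z ∈ Z, a⁻¹ • z ∈ closure Ω) ∧ ∃ z ∈ Z, a⁻¹ • z ∈ frontier Ω := by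
  set S : Set G := {a | ∀ z ∈ Z, a⁻¹ • z ∈ Ω} with hS
  have hSo : IsOpen S := by
    refine isOpen_iff_mem_nhds.2 fun a ha => ?_
    refine hZ.eventually_forall_of_forall_eventually fun z hz => ?_
    have hc : Continuous fun q : G × X => q.1⁻¹ • q.2 := continuous_fst.inv.smul continuous_snd
    exact (hΩ.preimage hc).mem_nhds (ha z hz)
  set C : Subgroup G := Subgroup.connectedComponentOfOne G with hC
  have hCo : IsOpen (C : Set G) := isOpen_connectedComponent
  have hCc : IsPreconnected (C : Set G) := isPreconnected_connectedComponent
  -- If `S` is relatively closed in the identity component `C`, then `C ⊆ S` and the `C`-orbit of a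
  -- point of `Z` stays in `Ω`. This orbit is open and closed, so it equals the connected set `Ω`,
  -- which then has no frontier. Otherwise a limit point of `S` outside `S` is the required
  -- translation.
  by_cases hsub : closure S ∩ (C : Set G) ⊆ S
  · exfalso
    have hCS : (C : Set G) ⊆ S :=
      hCc.subset_of_closure_inter_subset hSo ⟨1, C.one_mem, fun z hz => by simpa using hZΩ hz⟩ hsub
    obtain ⟨z, hz⟩ := hZne
    set O : X → Set X := fun w => (fun a : G => a • w) '' (C : Set G) with hO
    have hOo : ∀ w, IsOpen (O w) := fun w => horb w _ hCo
    have hOself : ∀ w, w ∈ O w := fun w => ⟨1, C.one_mem, one_smul G w⟩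
    have hOcl : closure (O z) ⊆ O z := by
      intro w hw
      obtain ⟨_, ⟨c, hc, rfl⟩, c', hc', he⟩ := mem_closure_iff.1 hw _ (hOo w) (hOself w)
      refine ⟨c⁻¹ * c', C.mul_mem (C.inv_mem hc) hc', ?_⟩
      simp only at he ⊢
      rw [mul_smul, he, inv_smul_smul]
    have hOΩ : O z ⊆ Ω := by
      rintro _ ⟨c, hc, rfl⟩
      have := hCS (C.inv_mem hc) z hz
      rwa [inv_inv] at this
    have hΩO : Ω ⊆ O z :=
      hconn.subset_of_closure_inter_subset (hOo z) ⟨z, hZΩ hz, hOself z⟩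
        (inter_subset_left.trans hOcl)
    have hclopen : IsClopen Ω := by
      rw [hΩO.antisymm hOΩ]
      exact ⟨isClosed_of_closure_subset hOcl, hOo z⟩
    rw [hclopen.frontier_eq] at hfr
    exact not_nonempty_empty hfr
  · obtain ⟨a, ⟨haS, -⟩, ha⟩ := not_subset.1 hsub
    have hcl : ∀ z ∈ Z, a⁻¹ • z ∈ closure Ω := fun z hz =>
      map_mem_closure (f := fun b : G => b⁻¹ • z) (continuous_inv.smul continuous_const) haS
        fun b hb => hb z hz
    simp only [hS, mem_ofPred_eq, not_forall] at ha
    obtain ⟨z, hz, hza⟩ := ha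
    refine ⟨a, hcl, z, hz, ?_⟩
    rw [hΩ.frontier_eq]
    exact ⟨hcl z hz, hza⟩

end Translation

/-! ### The a priori upper bound. -/

section APriori

variable {E : Type*} [NormedAddCommGroup E] [NormedSpace ℝ E] [FiniteDimensional ℝ E]
  {X : Type*} [TopologicalSpace X] [ChartedSpace E X] [IsManifold 𝓘(ℝ, E) ∞ X]
  [T2Space X] [LocallyCompactSpace X]
  {G : Type*} [Group G] [TopologicalSpace G] [IsTopologicalGroup G] [LocallyConnectedSpace G]
  [MulAction G X] [ContinuousSMul G X]

/-- Subharmonic functions with bounded boundary values are uniformly bounded above. -/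
theorem exists_upper_bound {F F' : Set (Jet2 E X)} (hopp : Opposed F F') (hneg : IsNegative F')
    (hsm : ∀ a : G, ContMDiff 𝓘(ℝ, E) 𝓘(ℝ, E) 2 (fun z : X => a • z))
    (horb : ∀ x : X, IsOpenMap fun a : G => a • x) (hinv : IsJetInvariant G F)
    {Ω : Set X} (hΩ : IsOpen Ω) (hconn : IsPreconnected Ω) (hcpt : IsCompact (closure Ω))
    (hfr : (frontier Ω).Nonempty) (hconv : HasStrictlyConvexBoundary F' Ω) (m : ℝ) :
    ∃ C, ∀ u : X → ℝ, UpperSemicontinuousOn u (closure Ω) → (∀ x ∈ frontier Ω, u x ≤ m) →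
      (∀ x ∈ Ω, m < u x → IsSubharmonicAt F u x) → ∀ x ∈ closure Ω, u x ≤ C := by
  -- The bound `2 * |m| + n + 1` sends the maxima to infinity and keeps half of each above `m`.
  -- Points with `u n > M n / 2` are therefore off the frontier, and `u n` is subharmonic there.
  by_contra! hcon
  choose u husc hum hut x hx hxu using fun n : ℕ => hcon (2 * |m| + n + 1)
  choose y hy hymax using fun n => (husc n).exists_isMaxOn ⟨x n, hx n⟩ hcpt
  set M : ℕ → ℝ := fun n => u n (y n) with hM
  have hMx : ∀ n, 2 * |m| + n + 1 < M n := fun n =>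
    (hxu n).trans_le (isMaxOn_iff.1 (hymax n) _ (hx n))
  have hMpos : ∀ n, 0 < M n := fun n => by
    have := hMx n
    have := abs_nonneg m
    have : (0 : ℝ) ≤ n := n.cast_nonneg
    linarith
  have hMm : ∀ n, m < M n / 2 := fun n => by
    have := hMx n
    have := le_abs_self m
    have : (0 : ℝ) ≤ n := n.cast_nonneg
    linarith
  have hMtop : Tendsto M atTop atTop := by
    refine tendsto_atTop_mono (fun n => ?_) tendsto_natCast_atTop_atTop
    have := hMx n
    have := abs_nonneg m
    linarith
  set K := closure Ω with hK
  have hKc : IsClosed K := isClosed_closure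
  set Z := relMaxSet K u M with hZ
  have hZK : Z ⊆ K := relMaxSet_subset hKc u M
  have hin : ∀ n, ∀ z ∈ K, M n / 2 < u n z → z ∈ Ω := by
    intro n z hz hzu
    by_contra hzΩ
    have : z ∈ frontier Ω := by
      rw [hΩ.frontier_eq]
      exact ⟨hz, hzΩ⟩
    linarith [hum n z this, hMm n]
  have hZfr : ∀ z ∈ Z, z ∉ frontier Ω := by
    intro z hz hzf
    obtain ⟨B, -, h, t₀, N, hb⟩ := (hconv z hzf 0).exists_isBarrier hzf univ_mem
    refine hb.notMem_relMaxSet hopp hneg hKc husc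
      (fun n w hw => isMaxOn_iff.1 (hymax n) w hw) hMpos hMtop (fun n w hw hwu => ?_) hZK hz
    have hwΩ := hin n w hw hwu
    exact ⟨mem_of_superset (hΩ.mem_nhds hwΩ) subset_closure,
      hut n w hwΩ ((hMm n).trans hwu)⟩
  have hZΩ : Z ⊆ Ω := by
    intro z hz
    by_contra hzΩ
    refine hZfr z hz ?_
    rw [hΩ.frontier_eq]
    exact ⟨hZK hz, hzΩ⟩
  have hZne : Z.Nonempty := relMaxSet_nonempty hcpt hMpos hy fun _ => rfl
  have hZcpt : IsCompact Z := hcpt.of_isClosed_subset (isClosed_relMaxSet K u M) hZK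
  -- The set `Z` avoids the frontier, so it can be moved until it touches; the barrier at the
  -- contact point is then applied to the translated functions.
  obtain ⟨a, hacl, z, hz, hzf⟩ := exists_smul_touching horb hΩ hconn hfr hZcpt hZne hZΩ
  set e : X ≃ₜ X := Homeomorph.smul a with he
  obtain ⟨B, -, h, t₀, N, hb⟩ := (hconv _ hzf 0).exists_isBarrier hzf univ_mem
  refine hb.notMem_relMaxSet hopp hneg (K := e ⁻¹' K) (v := fun n w => u n (e w)) (M := M)
    (hKc.preimage e.continuous) (fun n => ?_) (fun n w hw => isMaxOn_iff.1 (hymax n) _ hw)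
    hMpos hMtop (fun n w hw hwu => ?_) ?_ ((mem_relMaxSet_comp e).2 ?_)
  · exact (husc n).comp e.continuous.continuousOn fun w hw => hw
  · have hwΩ := hin n _ hw hwu
    refine ⟨mem_of_superset ((hΩ.preimage e.continuous).mem_nhds hwΩ)
      (preimage_mono subset_closure), ?_⟩
    exact (hut n _ hwΩ ((hMm n).trans hwu)).comp_smul hinv hsm
  · intro w hw
    have := hacl _ ((mem_relMaxSet_comp e).1 hw)
    simpa [he] using this
  · simpa [he] using hz

end APriori

/-! ### Upper semicontinuous envelopes. -/

section Envelope

variable {X : Type*} [TopologicalSpace X]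

/-- The upper semicontinuous envelope of `U` on `K`. -/
def uscEnvelope (K : Set X) (U : X → ℝ) (x : X) : ℝ :=
  sInf {y | ∀ᶠ z in 𝓝[K] x, U z ≤ y}

variable {K : Set X} {U : X → ℝ} {C : ℝ}

theorem bddBelow_uscEnvelope {x : X} (hx : x ∈ K) :
    BddBelow {y | ∀ᶠ z in 𝓝[K] x, U z ≤ y} :=
  ⟨U x, fun y (hy : ∀ᶠ z in 𝓝[K] x, U z ≤ y) => hy.self_of_nhdsWithin hx⟩

theorem le_uscEnvelope (hC : ∀ x ∈ K, U x ≤ C) {x : X} (hx : x ∈ K) : U x ≤ uscEnvelope K U x :=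
  le_csInf ⟨C, eventually_nhdsWithin_of_forall hC⟩
    fun y (hy : ∀ᶠ z in 𝓝[K] x, U z ≤ y) => hy.self_of_nhdsWithin hx

theorem uscEnvelope_le {x : X} (hx : x ∈ K) {y : ℝ} (h : ∀ᶠ z in 𝓝[K] x, U z ≤ y) :
    uscEnvelope K U x ≤ y :=
  csInf_le (bddBelow_uscEnvelope hx) h

theorem frequently_lt_of_lt_uscEnvelope {x : X} (hx : x ∈ K) {y : ℝ}
    (h : y < uscEnvelope K U x) : ∃ᶠ z in 𝓝[K] x, y < U z := by
  intro hcon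
  refine h.not_ge (uscEnvelope_le hx ?_)
  filter_upwards [hcon] with z hz using not_lt.1 hz

theorem upperSemicontinuousOn_uscEnvelope (hC : ∀ x ∈ K, U x ≤ C) :
    UpperSemicontinuousOn (uscEnvelope K U) K := by
  intro x hx
  refine upperSemicontinuousWithinAt_iff.2 ?_
  intro y hy
  obtain ⟨y', hy', hlt⟩ := exists_lt_of_csInf_lt ⟨C, eventually_nhdsWithin_of_forall hC⟩ hy
  have h := eventually_eventually_nhdsWithin.2 hy'
  filter_upwards [h, self_mem_nhdsWithin] with z hz hzK
  exact (uscEnvelope_le hzK hz).trans_lt hlt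

end Envelope

/-! ### Gluing by maxima. -/

section Glue

variable {X : Type*}

open Classical in
/-- The maximum of `u` and `g` on `B`, and `u` elsewhere. -/
def glue (B : Set X) (u g : X → ℝ) (z : X) : ℝ := if z ∈ B then max (u z) (g z) else u z

theorem le_glue (B : Set X) (u g : X → ℝ) (z : X) : u z ≤ glue B u g z := by
  unfold glue
  split_ifs
  · exact le_max_left _ _
  · exact le_rfl

theorem le_glue_of_mem {B : Set X} (u g : X → ℝ) {z : X} (hz : z ∈ B) : g z ≤ glue B u g z := by
  unfold glue
  rw [if_pos hz]
  exact le_max_right _ _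

theorem glue_eq_or {B : Set X} (u g : X → ℝ) (z : X) :
    glue B u g z = u z ∨ (z ∈ B ∧ u z < g z ∧ glue B u g z = g z) := by
  unfold glue
  split_ifs with h
  · rcases le_or_gt (g z) (u z) with h' | h'
    · exact Or.inl (max_eq_left h')
    · exact Or.inr ⟨h, h', max_eq_right h'.le⟩
  · exact Or.inl rfl

end Glue

/-! ### Perron competitors and their boundary behaviour. -/

section Perron

variable {E : Type*} [NormedAddCommGroup E] [NormedSpace ℝ E]
  {X : Type*} [TopologicalSpace X] [ChartedSpace E X]

/-- The competitors in the Perron method with boundary data `φ`, truncated below at `-k`. -/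
structure IsCompetitor (F : Set (Jet2 E X)) (Ω : Set X) (φ : X → ℝ) (k : ℝ) (u : X → ℝ) :
    Prop where
  lower : ∀ x ∈ closure Ω, -k ≤ u x
  usc : UpperSemicontinuousOn u (closure Ω)
  boundary : ∀ x ∈ frontier Ω, u x ≤ φ x
  sub : ∀ x ∈ Ω, -k < u x → IsSubharmonicAt F u x

/-- Where `u` wins, a test function for the glued function also tests `u`. Where `g` strictly wins,
`B` is a neighbourhood, so it tests `g`. Conditions on `g` are thus needed only where `u < g`;
closedness of `B` gives upper semicontinuity across its edge. -/
theorem IsCompetitor.glue {F : Set (Jet2 E X)} {Ω : Set X} {φ : X → ℝ} {k : ℝ} {u g : X → ℝ}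
    (hu : IsCompetitor F Ω φ k u) {B : Set X} (hB : IsClosed B)
    (hg : UpperSemicontinuousOn g (B ∩ closure Ω))
    (hφ : ∀ x ∈ frontier Ω, x ∈ B → u x < g x → g x ≤ φ x)
    (hsub : ∀ x ∈ Ω, x ∈ B → u x < g x → B ∈ 𝓝 x ∧ IsSubharmonicAt F g x) :
    IsCompetitor F Ω φ k (glue B u g) where
  lower x hx := (hu.lower x hx).trans (le_glue B u g x)
  usc := by
    intro x hx
    refine upperSemicontinuousWithinAt_iff.2 ?_
    intro y hy
    have h1 := (upperSemicontinuousWithinAt_iff.1 (hu.usc x hx)) y ((le_glue B u g x).trans_lt hy)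
    have h2 : ∀ᶠ z in 𝓝[closure Ω] x, z ∈ B → g z < y := by
      by_cases hxB : x ∈ B
      · have h3 := (upperSemicontinuousWithinAt_iff.1 (hg x ⟨hxB, hx⟩)) y
          ((le_glue_of_mem u g hxB).trans_lt hy)
        rw [eventually_nhdsWithin_iff] at h3 ⊢
        filter_upwards [h3] with z hz h4 h5 using hz ⟨h5, h4⟩
      · filter_upwards [mem_nhdsWithin_of_mem_nhds (hB.isOpen_compl.mem_nhds hxB)] with z hz h
        exact absurd h hz
    filter_upwards [h1, h2] with z h3 h4
    rcases glue_eq_or (B := B) u g z with h | ⟨h5, -, h⟩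
    · rwa [h]
    · rw [h]; exact h4 h5
  boundary x hx := by
    rcases glue_eq_or (B := B) u g x with h | ⟨h1, h2, h⟩
    · rw [h]; exact hu.boundary x hx
    · rw [h]; exact hφ x hx h1 h2
  sub x hx hk := by
    intro ψ hψ hle heq
    rcases glue_eq_or (B := B) u g x with h | ⟨h1, h2, h⟩
    · rw [h] at hk heq
      exact hu.sub x hx hk ψ hψ (hle.mono fun z hz => (le_glue B u g z).trans hz) heq
    · rw [h] at heq
      obtain ⟨h3, h4⟩ := hsub x hx h1 h2
      refine h4 ψ hψ ?_ heq
      filter_upwards [hle, h3] with z h5 h6 using (le_glue_of_mem u g h6).trans h5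

/-- Constants need not be subharmonic. Asking for subharmonicity only above `-k` makes this one a
competitor and gives the gluing constructions a starting point. -/
theorem isCompetitor_const {F : Set (Jet2 E X)} {Ω : Set X} {φ : X → ℝ} {k : ℝ}
    (hφ : ∀ x ∈ frontier Ω, -k ≤ φ x) : IsCompetitor F Ω φ k fun _ => -k where
  lower _ _ := le_rfl
  usc := upperSemicontinuousOn_const
  boundary := hφ
  sub _ _ h := absurd h (lt_irrefl _)

variable [IsManifold 𝓘(ℝ, E) ∞ X]

/-- Upper barriers: the competitors are equicontinuous from above at the boundary. -/
theorem eventually_competitor_le [FiniteDimensional ℝ E] [T2Space X] [LocallyCompactSpace X]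
    {F F' : Set (Jet2 E X)} (hopp : Opposed F F')
    (hneg : IsNegative F') {Ω : Set X} (hΩ : IsOpen Ω) (hconv : HasStrictlyConvexBoundary F' Ω)
    {φ : X → ℝ} (hφ : ContinuousOn φ (frontier Ω)) {k C : ℝ}
    (hC : ∀ u, IsCompetitor F Ω φ k u → ∀ x ∈ closure Ω, u x ≤ C)
    {x : X} (hx : x ∈ frontier Ω) (hk : -k ≤ φ x) {ε : ℝ} (hε : 0 < ε) :
    ∀ᶠ z in 𝓝[closure Ω] x, ∀ u, IsCompetitor F Ω φ k u → u z ≤ φ x + ε := by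
  set c := φ x + ε / 2 with hc
  have hxcl : x ∈ closure Ω := frontier_subset_closure hx
  have hO : {z | z ∈ frontier Ω → φ z < c} ∈ 𝓝 x :=
    eventually_nhdsWithin_iff.1 ((hφ x hx).eventually (gt_mem_nhds (by linarith)))
  -- The level is `-c` because touching would happen where `u > c`, so the negated value lies below
  -- `-c`.
  obtain ⟨B, hBO, h, t₀, N, hb⟩ := (hconv x hx (-c)).exists_isBarrier hx hO
  have hxB : x ∈ B := mem_of_mem_nhds hb.mem_nhds
  have hBcl : IsClosed B := hb.compact.isClosed
  have hBd : IsCompact ((B \ interior B) ∩ closure Ω) :=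
    (hb.compact.diff isOpen_interior).inter_right isClosed_closure
  obtain ⟨μ, hμ, hμh⟩ := hBd.exists_forall_le' (f := fun z => -h z) (a := 0)
    (hb.continuousOn.neg.mono fun z hz => hz.1.1) (fun z hz => by
      have hzx : z ≠ x := fun e => hz.1.2 (e ▸ mem_interior_iff_mem_nhds.2 hb.mem_nhds)
      linarith [hb.neg z hz.1.1 hz.2 hzx])
  -- With this `t`, on the edge of `B` the term `t * h ≤ -t * μ` brings every competitor, bounded by
  -- `C`, down to `φ x < c`, uniformly in the competitor.
  obtain ⟨t, ht, htμ⟩ : ∃ t ≥ t₀, C - φ x ≤ t * μ := by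
    refine ⟨max t₀ ((C - φ x) / μ), le_max_left _ _, ?_⟩
    have := mul_le_mul_of_nonneg_right (le_max_right t₀ ((C - φ x) / μ)) hμ.le
    rwa [div_mul_cancel₀ _ hμ.ne'] at this
  have htpos : 0 < t := hb.t₀_pos.trans_le ht
  have hmain : ∀ u, IsCompetitor F Ω φ k u → ∀ z ∈ B ∩ closure Ω, u z + t * h z ≤ c := by
    intro u hu
    have husc : UpperSemicontinuousOn (fun y => u y + t * h y) (B ∩ closure Ω) :=
      (hu.usc.mono inter_subset_right).add
        ((hb.continuousOn.mono inter_subset_left).const_mul t).upperSemicontinuousOn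
    obtain ⟨w, hw, hwmax⟩ := husc.exists_isMaxOn (show (B ∩ closure Ω).Nonempty from
      ⟨x, hxB, hxcl⟩) (hb.compact.inter_right isClosed_closure)
    obtain ⟨hwB, hwK⟩ := hw
    rw [isMaxOn_iff] at hwmax
    by_contra! hcon
    obtain ⟨z, hz, hzc⟩ := hcon
    have hval : c < u w + t * h w := hzc.trans_le (hwmax z hz)
    have hhw : t * h w ≤ 0 := mul_nonpos_of_nonneg_of_nonpos htpos.le (hb.nonpos hwB hwK)
    have hwint : w ∈ interior B := by
      by_contra hwi
      have h1 := mul_le_mul_of_nonneg_left (hμh w ⟨⟨hwB, hwi⟩, hwK⟩) htpos.le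
      have h2 := hC u hu w hwK
      linarith
    have hwΩ : w ∈ Ω := by
      by_contra hwΩ
      have hwf : w ∈ frontier Ω := by
        rw [hΩ.frontier_eq]; exact ⟨hwK, hwΩ⟩
      have h1 := hu.boundary w hwf
      have h2 : φ w < c := hBO hwB hwf
      linarith
    have hhw2 := hb.contMDiffAt w hwB
    refine hopp.jet2_notMem hneg hb.isOpen htpos (hb.scale_mem t ht) hhw2 (hb.redJet2_mem w hwB)
      (c := u w + t * h w) (by linarith) (hu.sub w hwΩ (by linarith) _ ?_ ?_ (by ring))
    · exact contMDiffAt_const.sub (contMDiffAt_const.mul hhw2)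
    · filter_upwards [hΩ.mem_nhds hwΩ, isOpen_interior.mem_nhds hwint] with y h1 h2
      have : u y + t * h y ≤ u w + t * h w := hwmax y ⟨interior_subset h2, subset_closure h1⟩
      linarith
  have hcont : ContinuousAt (fun z => t * h z) x :=
    (hb.contMDiffAt x hxB).continuousAt.const_mul t
  have hlow : ∀ᶠ z in 𝓝 x, -(ε / 2) < t * h z := by
    refine hcont.eventually (lt_mem_nhds ?_)
    simp only [hb.eq_zero]
    linarith
  filter_upwards [mem_nhdsWithin_of_mem_nhds hb.mem_nhds, self_mem_nhdsWithin,
    mem_nhdsWithin_of_mem_nhds hlow] with z h1 h2 h3 u hu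
  have h4 := hmain u hu z ⟨h1, h2⟩
  have h5 : -(ε / 2) < t * h z := h3
  linarith

/-- Lower barriers: at each boundary point some competitor nearly attains the boundary value. -/
theorem exists_competitor_ge [FiniteDimensional ℝ E] [T2Space X] [LocallyCompactSpace X]
    {F : Set (Jet2 E X)} (hF : IsSubequation F)
    {Ω : Set X} (hconv : HasStrictlyConvexBoundary F Ω)
    {φ : X → ℝ} (hφ : ContinuousOn φ (frontier Ω)) {k : ℝ} (hk : ∀ x ∈ frontier Ω, -k ≤ φ x)
    {x : X} (hx : x ∈ frontier Ω) {ε : ℝ} (hε : 0 < ε) :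
    ∃ u, IsCompetitor F Ω φ k u ∧ ∀ᶠ z in 𝓝[closure Ω] x, φ x - ε ≤ u z := by
  set c := φ x - ε / 2 with hc
  have hneg : IsNegative F := hF.negativity
  have hO : {z | z ∈ frontier Ω → c < φ z} ∈ 𝓝 x :=
    eventually_nhdsWithin_iff.1 ((hφ x hx).eventually (lt_mem_nhds (by linarith)))
  obtain ⟨B, hBO, h, t₀, N, hb⟩ := (hconv x hx c).exists_isBarrier hx hO
  have hxB : x ∈ B := mem_of_mem_nhds hb.mem_nhds
  have hBcl : IsClosed B := hb.compact.isClosed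
  have hBd : IsCompact ((B \ interior B) ∩ closure Ω) :=
    (hb.compact.diff isOpen_interior).inter_right isClosed_closure
  obtain ⟨μ, hμ, hμh⟩ := hBd.exists_forall_le' (f := fun z => -h z) (a := 0)
    (hb.continuousOn.neg.mono fun z hz => hz.1.1) (fun z hz => by
      have hzx : z ≠ x := fun e => hz.1.2 (e ▸ mem_interior_iff_mem_nhds.2 hb.mem_nhds)
      linarith [hb.neg z hz.1.1 hz.2 hzx])
  -- With this `t` the lower barrier `c + t * h` has dropped to `-k` or less on the edge of `B`, so
  -- it can be glued to `-k`.
  obtain ⟨t, ht, htμ⟩ : ∃ t ≥ t₀, c + k ≤ t * μ := by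
    refine ⟨max t₀ ((c + k) / μ), le_max_left _ _, ?_⟩
    have := mul_le_mul_of_nonneg_right (le_max_right t₀ ((c + k) / μ)) hμ.le
    rwa [div_mul_cancel₀ _ hμ.ne'] at this
  have htpos : 0 < t := hb.t₀_pos.trans_le ht
  have hgc : ∀ z ∈ B, ContMDiffAt 𝓘(ℝ, E) 𝓘(ℝ, ℝ) 2 (fun y => c + t * h y) z := fun z hz =>
    contMDiffAt_const.add (contMDiffAt_const.mul (hb.contMDiffAt z hz))
  have hgle : ∀ z ∈ B, z ∈ closure Ω → c + t * h z ≤ c := fun z hz hz' => by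
    have := mul_nonpos_of_nonneg_of_nonpos htpos.le (hb.nonpos hz hz')
    linarith
  refine ⟨glue B (fun _ => -k) (fun y => c + t * h y),
    (isCompetitor_const hk).glue hBcl ?_ ?_ ?_, ?_⟩
  · exact ContinuousOn.upperSemicontinuousOn fun z hz =>
      (hgc z hz.1).continuousAt.continuousWithinAt
  · intro z hz hzB _
    exact (hgle z hzB (frontier_subset_closure hz)).trans (hBO hzB hz).le
  · intro z hz hzB hlt
    have hzi : z ∈ interior B := by
      by_contra hcon
      have h1 := mul_le_mul_of_nonneg_left (hμh z ⟨⟨hzB, hcon⟩, subset_closure hz⟩) htpos.le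
      linarith
    refine ⟨mem_interior_iff_mem_nhds.1 hzi, fun ψ hψ hle heq => ?_⟩
    refine jet2_mem_of_le hF.positivity (hgc z hzB) hψ hle heq ?_
    exact hneg.jet2_mem (hb.contMDiffAt z hzB)
      (hb.scale_mem t ht _ (hb.redJet2_mem z hzB)) (hgle z hzB (subset_closure hz))
  · have hev : ∀ᶠ z in 𝓝 x, φ x - ε < c + t * h z := by
      refine (hgc x hxB).continuousAt.eventually (lt_mem_nhds ?_)
      simp only [hb.eq_zero]
      linarith
    filter_upwards [mem_nhdsWithin_of_mem_nhds hev, mem_nhdsWithin_of_mem_nhds hb.mem_nhds]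
      with z h1 h2
    exact (le_of_lt h1).trans (le_glue_of_mem (fun _ => -k) (fun y => c + t * h y) h2)

end Perron

/-! ### Interior continuity by translation. -/

section Continuity

variable {E : Type*} [NormedAddCommGroup E] [NormedSpace ℝ E]
  {X : Type*} [TopologicalSpace X] [ChartedSpace E X] [IsManifold 𝓘(ℝ, E) ∞ X]
  {G : Type*} [Group G] [TopologicalSpace G] [IsTopologicalGroup G]
  [MulAction G X] [ContinuousSMul G X]

/-- A maximal competitor decreases at most by `ε` under small translations. -/
theorem IsCompetitor.eventually_smul_le {F : Set (Jet2 E X)} (hF : IsNegative F)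
    (hsm : ∀ a : G, ContMDiff 𝓘(ℝ, E) 𝓘(ℝ, E) 2 (fun z : X => a • z))
    (hinv : IsJetInvariant G F) {Ω : Set X} (hΩ : IsOpen Ω) (hcpt : IsCompact (closure Ω))
    {φ : X → ℝ} {k : ℝ} {U : X → ℝ} (hU : IsCompetitor F Ω φ k U)
    (hmax : ∀ u, IsCompetitor F Ω φ k u → ∀ x ∈ closure Ω, u x ≤ U x)
    (hbdry : ∀ x ∈ frontier Ω, U x = φ x ∧ ContinuousWithinAt U (closure Ω) x)
    {ε : ℝ} (hε : 0 < ε) :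
    ∀ᶠ a : G in 𝓝 1, ∀ x ∈ closure Ω, a • x ∈ closure Ω → U (a • x) - ε ≤ U x := by
  have hfc : IsCompact (frontier Ω) := hcpt.of_isClosed_subset isClosed_frontier
    frontier_subset_closure
  -- The first half gives the boundary condition for the lowered translate. The second rules out
  -- that it exceeds `U` at a point of `Ω` which `a` moves onto the frontier.
  have hnear : ∀ᶠ a : G in 𝓝 1, ∀ y ∈ frontier Ω, y ∈ closure Ω →
      (a • y ∈ closure Ω → U (a • y) - ε ≤ U y) ∧
      (a⁻¹ • y ∈ closure Ω → U y - ε ≤ U (a⁻¹ • y)) := by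
    refine hfc.eventually_forall_of_forall_eventually fun y hy => ?_
    have hW : {z | z ∈ closure Ω → |U z - U y| < ε / 2} ∈ 𝓝 y := by
      refine eventually_nhdsWithin_iff.1 ?_
      have := (hbdry y hy).2.eventually (Metric.ball_mem_nhds (U y) (half_pos hε))
      filter_upwards [this] with z hz
      rwa [← Real.dist_eq]
    have c1 : Tendsto (fun q : G × X => q.2) (𝓝 (1, y)) (𝓝 y) := continuousAt_snd
    have c2 : Tendsto (fun q : G × X => q.1 • q.2) (𝓝 (1, y)) (𝓝 y) := by
      have : ContinuousAt (fun q : G × X => q.1 • q.2) (1, y) := continuous_smul.continuousAt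
      simpa [ContinuousAt] using this
    have c3 : Tendsto (fun q : G × X => q.1⁻¹ • q.2) (𝓝 (1, y)) (𝓝 y) := by
      have : ContinuousAt (fun q : G × X => q.1⁻¹ • q.2) (1, y) :=
        (continuous_fst.inv.smul continuous_snd).continuousAt
      simpa [ContinuousAt] using this
    filter_upwards [c1 hW, c2 hW, c3 hW] with q h1 h2 h3 hq
    have k1 := abs_lt.1 (h1 hq)
    constructor
    · intro h
      have k2 := abs_lt.1 (h2 h)
      linarith [k1.1, k2.2]
    · intro h
      have k2 := abs_lt.1 (h3 h)
      linarith [k1.2, k2.1]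
  filter_upwards [hnear] with a ha
  have hac : Continuous fun z : X => a • z := (hsm a).continuous
  have hcomp : IsCompetitor F Ω φ k
      (JetDirichlet.glue {x | a • x ∈ closure Ω} U fun x => U (a • x) - ε) := by
    refine hU.glue (isClosed_closure.preimage hac) ?_ ?_ ?_
    · have h1 : UpperSemicontinuousOn (fun x => U (a • x))
          ({x | a • x ∈ closure Ω} ∩ closure Ω) :=
        hU.usc.comp hac.continuousOn fun z hz => hz.1
      have h2 : UpperSemicontinuousOn (fun _ : X => -ε) ({x | a • x ∈ closure Ω} ∩ closure Ω) :=
        upperSemicontinuousOn_const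
      simpa only [sub_eq_add_neg] using h1.add h2
    · intro x hx hxB hlt
      exact absurd ((ha x hx (frontier_subset_closure hx)).1 hxB) (not_le.2 hlt)
    · intro x hx hxB hlt
      have haΩ : a • x ∈ Ω := by
        by_contra hcon
        have hf : a • x ∈ frontier Ω := by
          rw [hΩ.frontier_eq]; exact ⟨hxB, hcon⟩
        have := (ha _ hf hxB).2 (by rw [inv_smul_smul]; exact subset_closure hx)
        rw [inv_smul_smul] at this
        linarith
      refine ⟨mem_of_superset ((hΩ.preimage hac).mem_nhds haΩ)
        fun z hz => subset_closure hz, ?_⟩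
      have hk : -k < U (a • x) := by linarith [hU.lower x (subset_closure hx)]
      exact ((hU.sub _ haΩ hk).comp_smul hinv hsm).sub_const hF hε.le
  intro x hx hax
  exact (le_glue_of_mem U (fun x => U (a • x) - ε)
    (B := {x | a • x ∈ closure Ω}) hax).trans (hmax _ hcomp x hx)

/-- Only lower semicontinuity is missing. Since orbit maps are open, a point near `x` is `b • x`
with `b` near `1`, and the translation estimate for `b⁻¹` bounds `U (b • x)` below by nearly `U x`.
-/
theorem IsCompetitor.continuousOn {F : Set (Jet2 E X)} (hF : IsNegative F)
    (hsm : ∀ a : G, ContMDiff 𝓘(ℝ, E) 𝓘(ℝ, E) 2 (fun z : X => a • z))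
    (horb : ∀ x : X, IsOpenMap fun a : G => a • x)
    (hinv : IsJetInvariant G F) {Ω : Set X} (hΩ : IsOpen Ω) (hcpt : IsCompact (closure Ω))
    {φ : X → ℝ} {k : ℝ} {U : X → ℝ} (hU : IsCompetitor F Ω φ k U)
    (hmax : ∀ u, IsCompetitor F Ω φ k u → ∀ x ∈ closure Ω, u x ≤ U x)
    (hbdry : ∀ x ∈ frontier Ω, U x = φ x ∧ ContinuousWithinAt U (closure Ω) x) :
    ContinuousOn U (closure Ω) := by
  intro x hx
  refine tendsto_order.2 ⟨fun y hy => ?_, fun y hy => hU.usc x hx y hy⟩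
  have hV := hU.eventually_smul_le hF hsm hinv hΩ hcpt hmax hbdry
    (show 0 < (U x - y) / 2 by linarith)
  have hV' := inv_mem_nhds_one G hV
  have him := (horb x).image_mem_nhds hV'
  rw [one_smul] at him
  filter_upwards [mem_nhdsWithin_of_mem_nhds him, self_mem_nhdsWithin] with z hz hzcl
  obtain ⟨b, hb, rfl⟩ := hz
  have h1 : ∀ w ∈ closure Ω, b⁻¹ • w ∈ closure Ω → U (b⁻¹ • w) - (U x - y) / 2 ≤ U w := hb
  have h2 := h1 _ hzcl (by simpa using hx)
  simp only [inv_smul_smul] at h2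
  linarith

end Continuity

/-! ### The Perron solution and the Dirichlet problem. -/

section Perron

variable {E : Type*} [NormedAddCommGroup E] [NormedSpace ℝ E] [FiniteDimensional ℝ E]
  {X : Type*} [TopologicalSpace X] [ChartedSpace E X] [IsManifold 𝓘(ℝ, E) ∞ X]
  [LocallyCompactSpace X]

/-- The upper semicontinuous envelope of the supremum of all competitors is subharmonic. -/
theorem isSubharmonicAt_uscEnvelope {F : Set (Jet2 E X)} (hF : IsClosed F) {Ω : Set X}
    (hΩ : IsOpen Ω) {φ : X → ℝ} {k C : ℝ} {U : X → ℝ} (hC : ∀ x ∈ closure Ω, U x ≤ C)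
    (hle : ∀ u, IsCompetitor F Ω φ k u → ∀ x ∈ closure Ω, u x ≤ U x)
    (hsup : ∀ x ∈ closure Ω, ∀ y < U x, ∃ u, IsCompetitor F Ω φ k u ∧ y < u x)
    {x : X} (hx : x ∈ Ω) (hxk : -k < uscEnvelope (closure Ω) U x) :
    IsSubharmonicAt F (uscEnvelope (closure Ω) U) x := by
  intro ψ hψ hψle hψeq
  by_contra hcon
  set V := uscEnvelope (closure Ω) U with hV
  have hxcl : x ∈ closure Ω := subset_closure hx
  set κ := (V x + k) / 2 with hκ
  have hκpos : 0 < κ := by linarith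
  have hO : {z | z ∈ Ω ∧ V z ≤ ψ z ∧ -k + κ < ψ z} ∈ 𝓝 x := by
    filter_upwards [hΩ.mem_nhds hx, hψle, hψ.continuousAt.eventually
      (lt_mem_nhds (show -k + κ < ψ x by rw [← hψeq]; linarith))] with z h1 h2 h3
    exact ⟨h1, h2, h3⟩
  -- The complement of `F` is open, so `ψ` can be made strictly larger away from `x` with its nearby
  -- jets still outside `F`. A competitor almost reaching the envelope then touches a shift of this
  -- function at an interior point `w` of `B`.
  obtain ⟨B, hBO, hBc, hBn, hBs, δ₀, hδ₀, hsm, hjet⟩ :=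
    exists_perturbation hψ hO (hF.isOpen_compl.mem_nhds hcon)
  obtain ⟨μ, hμ, hμη⟩ := exists_chartDistSq_ge (E := E) hBc hBn hBs
  set d := δ₀ / 2 with hd
  have hdpos : 0 < d := by positivity
  -- At the maximum, `u - f > -2 * τ`. The three bounds keep `w` off the edge of `B`, make the shift
  -- an allowed perturbation, and ensure `u w > -k`.
  obtain ⟨τ, hτ, hτμ, hτδ, hτκ⟩ : ∃ τ > 0, 2 * τ < d * μ ∧ 2 * τ < δ₀ ∧ 2 * τ < κ := by
    have hm : 0 < min (d * μ) (min δ₀ κ) := lt_min (by positivity) (lt_min hδ₀ hκpos)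
    refine ⟨min (d * μ) (min δ₀ κ) / 3, by positivity, ?_, ?_, ?_⟩
    · linarith [min_le_left (d * μ) (min δ₀ κ)]
    · linarith [(min_le_right (d * μ) (min δ₀ κ)).trans (min_le_left _ _)]
    · linarith [(min_le_right (d * μ) (min δ₀ κ)).trans (min_le_right _ _)]
  set f : X → ℝ := fun y => ψ y + d * chartDistSq (E := E) x y with hf
  have hfx : f x = V x := by simp [hf, chartDistSq_self, hψeq]
  have hxB : x ∈ B := mem_of_mem_nhds hBn
  have hfc : ContinuousOn f B := fun z hz => (hsm d z hz).continuousAt.continuousWithinAt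
  have hnear : ∀ᶠ z in 𝓝[closure Ω] x, z ∈ B ∧ f z < V x + τ := by
    refine mem_nhdsWithin_of_mem_nhds (inter_mem hBn ?_)
    exact (hsm d x hxB).continuousAt.eventually (gt_mem_nhds (by
      change f x < _
      linarith))
  obtain ⟨z, hzU, ⟨hzB, hzf⟩, hzcl⟩ := ((frequently_lt_of_lt_uscEnvelope hxcl
    (show V x - τ < uscEnvelope (closure Ω) U x by linarith)).and_eventually
      (hnear.and self_mem_nhdsWithin)).exists
  obtain ⟨u, hu, huz⟩ := hsup z hzcl _ hzU
  have hBcl : B ⊆ closure Ω := fun y hy => subset_closure (hBO hy).1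
  have husc : UpperSemicontinuousOn (fun y => u y + -f y) B :=
    (hu.usc.mono hBcl).add hfc.neg.upperSemicontinuousOn
  obtain ⟨w, hwB, hwmax⟩ := husc.exists_isMaxOn ⟨z, hzB⟩ hBc
  rw [isMaxOn_iff] at hwmax
  have hwz := hwmax z hzB
  have huV : ∀ y ∈ B, u y ≤ ψ y := fun y hy =>
    ((hle u hu y (hBcl hy)).trans (le_uscEnvelope hC (hBcl hy))).trans (hBO hy).2.1
  have hwη : f w = ψ w + d * chartDistSq (E := E) x w := rfl
  have hηw : 0 ≤ d * chartDistSq (E := E) x w := mul_nonneg hdpos.le (sq_nonneg _)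
  have hwint : w ∈ interior B := by
    by_contra hwi
    have h1 := mul_le_mul_of_nonneg_left (hμη w ⟨hwB, hwi⟩) hdpos.le
    have h2 := huV w hwB
    linarith
  have hwΩ : w ∈ Ω := (hBO hwB).1
  have huk : -k < u w := by
    have := (hBO hwB).2.2
    linarith
  have hs : |u w + -f w| < δ₀ := by
    rw [abs_lt]
    constructor
    · linarith
    · linarith [huV w hwB]
  refine hjet w hwB d (u w + -f w) (by rw [abs_of_pos hdpos]; linarith) hs
    (hu.sub w hwΩ huk _ (contMDiffAt_const.add (hsm d w hwB)) ?_ ?_)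
  · filter_upwards [isOpen_interior.mem_nhds hwint] with y hy
    have : u y + -f y ≤ u w + -f w := hwmax y (interior_subset hy)
    change u y ≤ u w + -f w + f y
    linarith
  · change u w = u w + -f w + f w
    ring

variable [T2Space X]

/-- There is a largest competitor, and it attains the boundary values continuously. -/
theorem exists_maximal_competitor {F F' : Set (Jet2 E X)} (hF : IsSubequation F)
    (hopp : Opposed F F') (hneg : IsNegative F') {Ω : Set X} (hΩ : IsOpen Ω)
    (hconv : HasStrictlyConvexBoundary F Ω) (hconv' : HasStrictlyConvexBoundary F' Ω)
    {φ : X → ℝ} (hφ : ContinuousOn φ (frontier Ω)) {k C : ℝ}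
    (hC : ∀ u, IsCompetitor F Ω φ k u → ∀ x ∈ closure Ω, u x ≤ C)
    (hk : ∀ x ∈ frontier Ω, -k ≤ φ x) :
    ∃ U, IsCompetitor F Ω φ k U ∧
      (∀ u, IsCompetitor F Ω φ k u → ∀ x ∈ closure Ω, u x ≤ U x) ∧
      ∀ x ∈ frontier Ω, U x = φ x ∧ ContinuousWithinAt U (closure Ω) x := by
  set P : X → ℝ := fun x => sSup {y | ∃ u, IsCompetitor F Ω φ k u ∧ u x = y} with hP
  have hne : ∀ x, {y | ∃ u, IsCompetitor F Ω φ k u ∧ u x = y}.Nonempty := fun x =>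
    ⟨-k, _, isCompetitor_const hk, rfl⟩
  have hPC : ∀ x ∈ closure Ω, P x ≤ C := fun x hx =>
    csSup_le (hne x) (by rintro _ ⟨u, hu, rfl⟩; exact hC u hu x hx)
  have hle : ∀ u, IsCompetitor F Ω φ k u → ∀ x ∈ closure Ω, u x ≤ P x := fun u hu x hx =>
    le_csSup ⟨C, by rintro _ ⟨u, hu, rfl⟩; exact hC u hu x hx⟩ ⟨u, hu, rfl⟩
  have hsup : ∀ x ∈ closure Ω, ∀ y < P x, ∃ u, IsCompetitor F Ω φ k u ∧ y < u x := by
    intro x _ y hy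
    obtain ⟨_, ⟨u, hu, rfl⟩, hlt⟩ := exists_lt_of_lt_csSup (hne x) hy
    exact ⟨u, hu, hlt⟩
  have hleV := fun x (hx : x ∈ closure Ω) => le_uscEnvelope hPC hx
  have hV : IsCompetitor F Ω φ k (uscEnvelope (closure Ω) P) :=
    { lower := fun x hx => (hle _ (isCompetitor_const hk) x hx).trans (hleV x hx)
      usc := upperSemicontinuousOn_uscEnvelope hPC
      boundary := by
        intro x hx
        refine le_of_forall_pos_le_add fun ε hε => ?_
        refine uscEnvelope_le (frontier_subset_closure hx) ?_
        -- The upper barrier works for all competitors on one neighbourhood, so the boundary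
        -- inequality survives both the supremum and the envelope.
        filter_upwards [eventually_competitor_le hopp hneg hΩ hconv' hφ hC hx (hk x hx) hε]
          with z hz
        exact csSup_le (hne z) (by rintro _ ⟨u, hu, rfl⟩; exact hz u hu)
      sub := fun x hx hxk => isSubharmonicAt_uscEnvelope hF.isClosed hΩ hPC hle hsup hx hxk }
  have hmax : ∀ u, IsCompetitor F Ω φ k u → ∀ x ∈ closure Ω,
      u x ≤ uscEnvelope (closure Ω) P x := fun u hu x hx => (hle u hu x hx).trans (hleV x hx)
  have hlow : ∀ x ∈ frontier Ω, ∀ ε > 0,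
      ∀ᶠ z in 𝓝[closure Ω] x, φ x - ε ≤ uscEnvelope (closure Ω) P z := by
    intro x hx ε hε
    obtain ⟨u, hu, hev⟩ := exists_competitor_ge hF hconv hφ hk hx hε
    filter_upwards [hev, self_mem_nhdsWithin] with z h1 h2
    exact h1.trans (hmax u hu z h2)
  refine ⟨_, hV, hmax, fun x hx => ?_⟩
  have hxcl := frontier_subset_closure hx
  have heq : uscEnvelope (closure Ω) P x = φ x := by
    refine le_antisymm (hV.boundary x hx) (le_of_forall_pos_le_add fun ε hε => ?_)
    linarith [(hlow x hx ε hε).self_of_nhdsWithin hxcl]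
  refine ⟨heq, tendsto_order.2 ⟨fun y hy => ?_, fun y hy => hV.usc x hxcl y hy⟩⟩
  filter_upwards [hlow x hx ((φ x - y) / 2) (by linarith)] with z hz
  linarith

/-- The negative of a continuous maximal competitor is subharmonic for the dual subequation. -/
theorem IsCompetitor.isSubharmonicAt_dual {F : Set (Jet2 E X)} (hF : IsSubequation F) {Ω : Set X}
    (hΩ : IsOpen Ω) {φ : X → ℝ} {k : ℝ} {U : X → ℝ} (hU : IsCompetitor F Ω φ k U)
    (hmax : ∀ u, IsCompetitor F Ω φ k u → ∀ x ∈ closure Ω, u x ≤ U x)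
    {x : X} (hx : x ∈ Ω) : IsSubharmonicAt (dual F) (fun z => -U z) x := by
  intro ψ hψ hle heq hint
  rw [← jet2_neg hψ] at hint
  obtain ⟨B, hBO, hBc, hBn, hBs, δ₀, hδ₀, hsm, hjet⟩ :=
    exists_perturbation hψ.neg (inter_mem (hΩ.mem_nhds hx) hle) (isOpen_interior.mem_nhds hint)
  obtain ⟨μ, hμ, hμη⟩ := exists_chartDistSq_ge (E := E) hBc hBn hBs
  set d := δ₀ / 2 with hd
  have hdpos : 0 < d := by positivity
  -- The bump `g` exceeds `U` by `s` at `x`. The condition `s < d * μ` puts it below `U` on the edge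
  -- of `B`, and `s < δ₀` keeps its jets in the interior of `F`.
  obtain ⟨s, hs, hsδ, hsμ⟩ : ∃ s > 0, s < δ₀ ∧ s < d * μ := by
    have hm : 0 < min δ₀ (d * μ) := lt_min hδ₀ (by positivity)
    exact ⟨min δ₀ (d * μ) / 2, by positivity, by linarith [min_le_left δ₀ (d * μ)],
      by linarith [min_le_right δ₀ (d * μ)]⟩
  set g : X → ℝ := fun y => s + (-ψ y + -d * chartDistSq (E := E) x y) with hg
  have hgc : ∀ z ∈ B, ContMDiffAt 𝓘(ℝ, E) 𝓘(ℝ, ℝ) 2 g z := fun z hz =>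
    contMDiffAt_const.add (hsm (-d) z hz)
  have hcomp : IsCompetitor F Ω φ k (JetDirichlet.glue B U g) := by
    refine hU.glue hBc.isClosed ?_ ?_ ?_
    · exact ContinuousOn.upperSemicontinuousOn fun z hz =>
        (hgc z hz.1).continuousAt.continuousWithinAt
    · intro z hz hzB
      rw [hΩ.frontier_eq] at hz
      exact absurd (hBO hzB).1 hz.2
    · intro z hz hzB hlt
      have hzi : z ∈ interior B := by
        by_contra hcon
        have h1 := mul_le_mul_of_nonneg_left (hμη z ⟨hzB, hcon⟩) hdpos.le
        have h2 : -U z ≤ ψ z := (hBO hzB).2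
        have h3 : U z < s + (-ψ z + -d * chartDistSq (E := E) x z) := hlt
        linarith
      refine ⟨mem_interior_iff_mem_nhds.1 hzi, fun χ hχ hχle hχeq => ?_⟩
      refine jet2_mem_of_le hF.positivity (hgc z hzB) hχ hχle hχeq ?_
      exact interior_subset (hjet z hzB (-d) s (by rw [abs_neg, abs_of_pos hdpos]; linarith)
        (by rwa [abs_of_pos hs]))
  have h1 := hmax _ hcomp x (subset_closure hx)
  have h2 := le_glue_of_mem U g (mem_of_mem_nhds hBn)
  have h3 : g x = s + -ψ x := by simp [hg, chartDistSq_self]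
  linarith

variable {G : Type*} [Group G] [TopologicalSpace G] [IsTopologicalGroup G]
  [MulAction G X] [ContinuousSMul G X]

/-- Existence for the Dirichlet problem for an invariant subequation, on a manifold with a group
action whose orbit maps are open. -/
theorem dirichletExistence_of_isJetInvariant [LocallyConnectedSpace G]
    (hsm : ∀ a : G, ContMDiff 𝓘(ℝ, E) 𝓘(ℝ, E) 2 (fun z : X => a • z))
    (horb : ∀ x : X, IsOpenMap fun a : G => a • x)
    {F : Set (Jet2 E X)} (hF : IsSubequation F) (hinv : IsJetInvariant G F)
    {Ω : Set X} (hΩ : IsOpen Ω) (hconn : IsPreconnected Ω) (hcpt : IsCompact (closure Ω))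
    (hfr : (frontier Ω).Nonempty) (hconv : HasStrictlyConvexBoundary F Ω)
    (hconv' : HasStrictlyConvexBoundary (dual F) Ω) : DirichletExistence F Ω := by
  intro φ hφ
  have hneg : IsNegative F := hF.negativity
  have hopp : Opposed F (dual F) := opposed_dual hF.eq_closure_interior
  have hfc : IsCompact (frontier Ω) := hcpt.of_isClosed_subset isClosed_frontier
    frontier_subset_closure
  obtain ⟨m, hm⟩ := hfc.exists_bound_of_continuousOn hφ
  simp only [Real.norm_eq_abs, abs_le] at hm
  obtain ⟨C, hC⟩ := exists_upper_bound hopp hneg.dual hsm horb hinv hΩ hconn hcpt hfr hconv' m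
  obtain ⟨C', hC'⟩ := exists_upper_bound (dual_opposed F) hneg hsm horb
    (hinv.dual hF hsm) hΩ hconn hcpt hfr hconv m
  -- Neither `C` nor `C'` depends on `k`. Taking `|m| < k` makes `-k` lie below the boundary data
  -- and makes competitors subharmonic above `m`; `C' < k` turns `-U ≤ C'` into `U > -k`, so `U` is
  -- subharmonic on all of `Ω`.
  obtain ⟨k, hkm, hkC⟩ : ∃ k, |m| < k ∧ C' < k :=
    ⟨max |m| C' + 1, by linarith [le_max_left |m| C'], by linarith [le_max_right |m| C']⟩
  have hm1 := (abs_lt.1 hkm).1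
  have hm2 := (abs_lt.1 hkm).2
  have hbound : ∀ u, IsCompetitor F Ω φ k u → ∀ x ∈ closure Ω, u x ≤ C := fun u hu =>
    hC u hu.usc (fun x hx => (hu.boundary x hx).trans (hm x hx).2)
      fun x hx hlt => hu.sub x hx (by linarith)
  have hk : ∀ x ∈ frontier Ω, -k ≤ φ x := fun x hx => by linarith [(hm x hx).1]
  obtain ⟨U, hU, hmax, hbdry⟩ :=
    exists_maximal_competitor hF hopp hneg.dual hΩ hconv hconv' hφ hbound hk
  have hcont : ContinuousOn U (closure Ω) :=
    hU.continuousOn hneg hsm horb hinv hΩ hcpt hmax hbdry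
  have hdual : ∀ x ∈ Ω, IsSubharmonicAt (dual F) (fun z => -U z) x := fun x hx =>
    hU.isSubharmonicAt_dual hF hΩ hmax hx
  have hlow := hC' (fun z => -U z) hcont.neg.upperSemicontinuousOn
    (fun x hx => by
      rw [(hbdry x hx).1]
      linarith [(hm x hx).1])
    (fun x hx _ => hdual x hx)
  have hsub : ∀ x ∈ Ω, IsSubharmonicAt F U x := fun x hx =>
    hU.sub x hx (by linarith [hlow x (subset_closure hx)])
  have hcontΩ := hcont.mono subset_closure
  refine ⟨U, hcont, ⟨⟨?_, fun _ _ => EReal.coe_lt_top _, ?_⟩, ?_, fun _ _ => EReal.coe_lt_top _, ?_⟩,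
    fun x hx => (hbdry x hx).1⟩
  · exact (continuous_coe_real_ereal.comp_continuousOn hcontΩ).upperSemicontinuousOn
  · intro x hx ψ hψ hle heq
    exact hsub x hx ψ hψ (hle.mono fun z hz => EReal.coe_le_coe_iff.1 hz)
      (EReal.coe_eq_coe_iff.1 heq)
  · exact (continuous_coe_real_ereal.comp_continuousOn hcontΩ.neg).upperSemicontinuousOn
  · intro x hx ψ hψ hle heq
    exact hdual x hx ψ hψ (hle.mono fun z hz => EReal.coe_le_coe_iff.1 hz)
      (EReal.coe_eq_coe_iff.1 heq)

end Perron

end JetDirichlet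

end

/-! ### The case of `G ⧸ H`. -/

theorem theorem8p1p3
    {EG : Type*} [NormedAddCommGroup EG] [NormedSpace ℝ EG] [FiniteDimensional ℝ EG]
    {G : Type*} [Group G] [TopologicalSpace G] [ChartedSpace EG G] [LieGroup 𝓘(ℝ, EG) ∞ G]
    (H : Subgroup G) (hH : IsClosed (H : Set G))
    {E : Type*} [NormedAddCommGroup E] [NormedSpace ℝ E] [FiniteDimensional ℝ E]
    [ChartedSpace E (G ⧸ H)] [IsManifold 𝓘(ℝ, E) ∞ (G ⧸ H)]
    (hsmooth : ContMDiff (𝓘(ℝ, EG).prod 𝓘(ℝ, E)) 𝓘(ℝ, E) ∞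
      (fun q : G × (G ⧸ H) => q.1 • q.2))
    (g : JetDirichlet.SmoothMetric E (G ⧸ H)) (hg : JetDirichlet.IsMetricInvariant G g)
    (F : Set (JetDirichlet.Jet2 E (G ⧸ H))) (hF : JetDirichlet.IsSubequation F)
    (hinv : JetDirichlet.IsJetInvariant G F)
    (Ω : Set (G ⧸ H)) (hopen : IsOpen Ω) (hconn : IsConnected Ω)
    (hcpt : IsCompact (closure Ω)) (hbdry : (frontier Ω).Nonempty)
    (hconv : JetDirichlet.HasStrictlyConvexBoundary F Ω)
    (hconv' : JetDirichlet.HasStrictlyConvexBoundary (JetDirichlet.dual F) Ω) :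
    JetDirichlet.DirichletExistence F Ω := by
  have : IsTopologicalGroup G := topologicalGroup_of_lieGroup 𝓘(ℝ, EG) ∞
  have : ContinuousSMul G (G ⧸ H) := ⟨hsmooth.continuous⟩
  have : LocallyConnectedSpace G := ChartedSpace.locallyConnectedSpace EG G
  have : LocallyCompactSpace (G ⧸ H) := ChartedSpace.locallyCompactSpace E (G ⧸ H)
  have : T2Space (G ⧸ H) := by
    rw [t2Space_iff_of_isOpenQuotientMap
      (QuotientGroup.isOpenQuotientMap_mk : IsOpenQuotientMap (QuotientGroup.mk : G → G ⧸ H))]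
    have : {q : G × G | (QuotientGroup.mk q.1 : G ⧸ H) = QuotientGroup.mk q.2} =
        (fun q : G × G => q.1⁻¹ * q.2) ⁻¹' (H : Set G) := by
      ext q
      exact QuotientGroup.eq
    exact this ▸ hH.preimage (continuous_fst.inv.mul continuous_snd)
  have hsm : ∀ a : G, ContMDiff 𝓘(ℝ, E) 𝓘(ℝ, E) 2 (fun z : G ⧸ H => a • z) := fun a =>
    (hsmooth.comp (contMDiff_const.prodMk contMDiff_id)).of_le (by decide)
  -- The orbit map of the coset of `b` is right multiplication by `b` followed by the open quotient
  -- map.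
  have horb : ∀ x : G ⧸ H, IsOpenMap fun a : G => a • x := by
    intro x
    induction x using QuotientGroup.induction_on with
    | H b => exact QuotientGroup.isOpenMap_coe.comp (isOpenMap_mul_right b)
  exact JetDirichlet.dirichletExistence_of_isJetInvariant hsm horb hF hinv hopen
    hconn.isPreconnected hcpt hbdry hconv hconv'
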